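/- Let $H^{1/2}(\mathbb{R}_+)$ be the space of real-valued $f\in L^2(0,\infty)$ with $$\|f\|_{H^{1/2}}^2:=\int_0^\infty |f(t)|^2\,dt+\int_0^\infty\!\!\int_0^\infty \frac{|f(x)-f(y)|^2}{|x-y|^2}\,dx\,dy<\infty .$$ Put $t^*=t$ for $0\le t\le 1$ and $t^*=1$ for $t>1$, and let $H^{1/2}_{00}(\mathbb{R}_+)$ be the space of $f\in H^{1/2}(\mathbb{R}_+)$ with $(t^*)^{-1/2}f\in L^2(0,\infty)$, with the norm $$\|f\|_{H^{1/2}_{00}}^2:=\|f\|_{H^{1/2}}^2+\int_0^\infty (t^*)^{-1}|f(t)|^2\,dt .$$ **Lemma ($H^{1/2}_{00}$-estimate).** The bilinear form $$\mathscr{B}(f,g)=\int_0^\infty f'g\,dt=-\int_0^\infty f g'\,dt,\qquad f,g\in C_c^\infty((0,\infty)),$$ extends uniquely to a bounded bilinear form $\mathscr{B}:H^{1/2}_{00}(\mathbb{R}_+)\times H^{1/2}(\mathbb{R}_+)\to\mathbb{R}$. That is, there is a constant $C$ such that $$|\mathscr{B}(f,g)|\le C\,\|f\|_{H^{1/2}_{00}}\|g\|_{H^{1/2}}\qquad\text{for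 all } f\in H^{1/2}_{00}(\mathbb{R}_+),\ g\in H^{1/2}(\mathbb{R}_+).$$ For $f\in H^{1/2}_{00}(\mathbb{R}_+)$ and $g\in H^{1/2}(\mathbb{R}_+)$ one has moreover $\mathscr{B}(f,g)=\int_0^\infty f'g\,dt$ whenever $f$ has a weak derivative $f'\in L^2(0,\infty)$, and $\mathscr{B}(f,g)=-\int_0^\infty f g'\,dt$ whenever $g$ has a weak derivative $g'\in L^2(0,\infty)$. In this sense $$\Big|\int_0^\infty f'g\,dt\Big|=\Big|\int_0^\infty f g'\,dt\Big|\lesssim\|f\|_{H^{1/2}_{00}}\|g\|_{H^{1/2}} .$$ -/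

import Mathlib

open MeasureTheory Set
open scoped Distributions ENNReal

noncomputable section

namespace HalfLine

/-- The open half-line `(0, ∞)`. -/
def halfLine : TopologicalSpace.Opens ℝ := ⟨Ioi 0, isOpen_Ioi⟩

/-- Lebesgue measure on `(0, ∞)`. -/
abbrev vol : Measure ℝ := volume.restrict (Ioi 0)

/-- The real Hilbert space `L²(0, ∞)`. -/
abbrev L2 : Type := Lp ℝ 2 vol

/-- The difference quotient `(f x - f y) / |x - y|`, whose square is the Gagliardo (Sobolev-Slobodeckij)
kernel `|f x - f y|² / |x - y|^{1 + 2s}` for `s = 1/2` in dimension one. -/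
def diffQuot (f : ℝ → ℝ) (p : ℝ × ℝ) : ℝ := (f p.1 - f p.2) / |p.1 - p.2|

/-- The weight function `t* = t` on `[0, 1]` and `t* = 1` on `(1, ∞)`. -/
def tstar (t : ℝ) : ℝ := if t ≤ 1 then t else 1

theorem diffQuot_congr {f g : ℝ → ℝ} (h : f =ᵐ[vol] g) :
    diffQuot f =ᵐ[vol.prod vol] diffQuot g := by
  have h1 := Measure.quasiMeasurePreserving_fst (μ := vol) (ν := vol) |>.ae_eq_comp h
  have h2 := Measure.quasiMeasurePreserving_snd (μ := vol) (ν := vol) |>.ae_eq_comp h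
  filter_upwards [h1, h2] with p hp1 hp2
  simp only [Function.comp_apply] at hp1 hp2
  simp only [diffQuot, hp1, hp2]

/-- The Sobolev space `H^{1/2}(0, ∞)`: all `f ∈ L²(0, ∞)` with finite Gagliardo seminorm. -/
def HHalf : Submodule ℝ L2 where
  carrier := {f | MemLp (diffQuot f) 2 (vol.prod vol)}
  zero_mem' := by
    have h : diffQuot (⇑(0 : L2)) =ᵐ[vol.prod vol] fun _ => 0 :=
      (diffQuot_congr (Lp.coeFn_zero ℝ 2 vol)).trans
        (Filter.Eventually.of_forall fun p => by simp [diffQuot])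
    exact (memLp_congr_ae h).2 MemLp.zero'
  add_mem' := by
    intro f g hf hg
    have h : diffQuot (⇑(f + g)) =ᵐ[vol.prod vol] diffQuot f + diffQuot g :=
      (diffQuot_congr (Lp.coeFn_add f g)).trans
        (Filter.Eventually.of_forall fun p => by simp only [diffQuot, Pi.add_apply]; ring)
    exact (memLp_congr_ae h).2 (MemLp.add hf hg)
  smul_mem' := by
    intro c f hf
    have h : diffQuot (⇑(c • f)) =ᵐ[vol.prod vol] c • diffQuot f :=
      (diffQuot_congr (Lp.coeFn_smul c f)).trans
        (Filter.Eventually.of_forall fun p => by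
          simp only [diffQuot, Pi.smul_apply, smul_eq_mul]; ring)
    exact (memLp_congr_ae h).2 (MemLp.const_smul hf c)

/-- The function `(t*)^{-1/2} f`. -/
def weighted (f : ℝ → ℝ) (t : ℝ) : ℝ := tstar t ^ (-(1 / 2) : ℝ) * f t

theorem weighted_congr {f g : ℝ → ℝ} (h : f =ᵐ[vol] g) : weighted f =ᵐ[vol] weighted g := by
  filter_upwards [h] with t ht
  simp only [weighted, ht]

/-- The space `H^{1/2}_{00}(0, ∞)`: all `f ∈ H^{1/2}(0, ∞)` with `(t*)^{-1/2} f ∈ L²(0, ∞)`. -/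
def HHalf00 : Submodule ℝ L2 where
  carrier := {f | f ∈ HHalf ∧ MemLp (weighted f) 2 vol}
  zero_mem' := by
    refine ⟨HHalf.zero_mem, ?_⟩
    have h : weighted (⇑(0 : L2)) =ᵐ[vol] fun _ => 0 :=
      (weighted_congr (Lp.coeFn_zero ℝ 2 vol)).trans
        (Filter.Eventually.of_forall fun p => by simp [weighted])
    exact (memLp_congr_ae h).2 MemLp.zero'
  add_mem' := by
    intro f g hf hg
    refine ⟨HHalf.add_mem hf.1 hg.1, ?_⟩
    have h : weighted (⇑(f + g)) =ᵐ[vol] weighted f + weighted g :=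
      (weighted_congr (Lp.coeFn_add f g)).trans
        (Filter.Eventually.of_forall fun p => by simp only [weighted, Pi.add_apply]; ring)
    exact (memLp_congr_ae h).2 (MemLp.add hf.2 hg.2)
  smul_mem' := by
    intro c f hf
    refine ⟨HHalf.smul_mem c hf.1, ?_⟩
    have h : weighted (⇑(c • f)) =ᵐ[vol] c • weighted f :=
      (weighted_congr (Lp.coeFn_smul c f)).trans
        (Filter.Eventually.of_forall fun p => by
          simp only [weighted, Pi.smul_apply, smul_eq_mul]; ring)
    exact (memLp_congr_ae h).2 (MemLp.const_smul hf.2 c)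

/-- The `H^{1/2}(0, ∞)` norm
`(∫ |f|² + ∬ |f x - f y|² / |x - y|² dx dy)^{1/2}`; it is used on `HHalf` only. -/
def normHHalf (f : L2) : ℝ :=
  Real.sqrt ((∫ t, f t ^ 2 ∂vol) + ∫ p, diffQuot f p ^ 2 ∂(vol.prod vol))

/-- The `H^{1/2}_{00}(0, ∞)` norm `(‖f‖²_{H^{1/2}} + ∫ (t*)⁻¹ |f|²)^{1/2}`; it is used on
`HHalf00` only. -/
def normHHalf00 (f : L2) : ℝ :=
  Real.sqrt (normHHalf f ^ 2 + ∫ t, (tstar t)⁻¹ * f t ^ 2 ∂vol)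

/-- `f'` is the weak derivative of `f` on `(0, ∞)`. -/
def HasWeakDeriv (f f' : L2) : Prop :=
  ∀ φ : 𝓓(halfLine, ℝ), ∫ t, f t * deriv φ t ∂vol = -∫ t, f' t * φ t ∂vol

theorem testFunction_memLp (φ : 𝓓(halfLine, ℝ)) : MemLp φ 2 vol :=
  (φ.continuous.memLp_of_hasCompactSupport φ.hasCompactSupport).restrict _

/-- A test function as an element of `L²(0, ∞)`. -/
def testL2 (φ : 𝓓(halfLine, ℝ)) : L2 := (testFunction_memLp φ).toLp φ

theorem testL2_ae (φ : 𝓓(halfLine, ℝ)) : testL2 φ =ᵐ[vol] φ := MemLp.coeFn_toLp _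

theorem diffQuot_testFunction_memLp (φ : 𝓓(halfLine, ℝ)) :
    MemLp (diffQuot φ) 2 (vol.prod vol) := by
  obtain ⟨L, hL⟩ := φ.contDiff.lipschitzWith_of_hasCompactSupport φ.hasCompactSupport (by simp)
  obtain ⟨M, hM⟩ := φ.continuous.bounded_above_of_compact_support φ.hasCompactSupport
  have hM0 : 0 ≤ M := (norm_nonneg _).trans (hM 0)
  set S : Set ℝ := tsupport φ
  have hSc : IsCompact S := φ.hasCompactSupport
  set K : ℝ := L + 2 * M
  have hL0 : (0 : ℝ) ≤ L := L.2
  have hK : 0 ≤ K := by positivity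
  have hmeas : Measurable (diffQuot φ) := by
    have := φ.continuous.measurable
    unfold diffQuot
    fun_prop
  rw [memLp_two_iff_integrable_sq hmeas.aestronglyMeasurable]
  -- the dominating kernel
  set F : ℝ → ℝ := S.indicator fun _ => 1
  set G : ℝ → ℝ := fun x => (1 + ‖x‖) ^ (-2 : ℝ)
  have hF : Integrable F volume :=
    (integrable_indicator_iff hSc.measurableSet).2 (integrableOn_const hSc.measure_lt_top.ne)
  have hG : Integrable G volume := integrable_one_add_norm (by simp)
  have hA : Integrable (fun p : ℝ × ℝ => F p.2 * G (p.1 - p.2)) (volume.prod volume) :=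
    Integrable.convolution_integrand (ContinuousLinearMap.mul ℝ ℝ) hF hG
  have hB : Integrable (fun p : ℝ × ℝ => F p.1 * G (p.2 - p.1)) (volume.prod volume) := hA.swap
  have hAB : Integrable (fun p : ℝ × ℝ =>
      K ^ 2 * (F p.2 * G (p.1 - p.2) + F p.1 * G (p.2 - p.1))) (vol.prod vol) := by
    rw [Measure.prod_restrict]
    exact ((hA.add hB).const_mul (K ^ 2)).restrict
  refine hAB.mono' (hmeas.pow_const 2).aestronglyMeasurable
    (Filter.Eventually.of_forall fun p => ?_)
  obtain ⟨x, y⟩ := p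
  have hF0 : ∀ z, 0 ≤ F z := fun z => indicator_nonneg (fun _ _ => zero_le_one) z
  have hGe : ∀ z, G z = ((1 + |z|) ^ 2)⁻¹ := fun z => by
    simp only [G, Real.norm_eq_abs]
    rw [Real.rpow_neg (by positivity)]
    norm_cast
  rw [Real.norm_eq_abs, abs_of_nonneg (sq_nonneg _)]
  simp only [hGe, abs_sub_comm y x, ← add_mul, diffQuot]
  by_cases hxy : x ∈ S ∨ y ∈ S
  · have hFS : 1 ≤ F y + F x := by
      rcases hxy with h | h
      · have : F x = 1 := by simp [F, h]
        linarith [hF0 y]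
      · have : F y = 1 := by simp [F, h]
        linarith [hF0 x]
    have hq : ((φ x - φ y) / |x - y|) ^ 2 ≤ K ^ 2 * ((1 + |x - y|) ^ 2)⁻¹ := by
      rw [← div_eq_mul_inv, ← div_pow, ← sq_abs, abs_div, abs_abs]
      apply pow_le_pow_left₀ (by positivity)
      rcases eq_or_ne x y with rfl | hne
      · simp only [sub_self, abs_zero, div_zero]; positivity
      · have hd : 0 < |x - y| := abs_pos.2 (sub_ne_zero.2 hne)
        have h1 : |φ x - φ y| ≤ L * |x - y| := by
          simpa [Real.dist_eq] using hL.dist_le_mul x y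
        have h2 : |φ x - φ y| ≤ 2 * M := by
          have := abs_sub (φ x) (φ y)
          have hx := hM x
          have hy := hM y
          rw [Real.norm_eq_abs] at hx hy
          linarith
        rw [div_le_div_iff₀ hd (by positivity)]
        nlinarith
    calc _ ≤ K ^ 2 * ((1 + |x - y|) ^ 2)⁻¹ := hq
      _ ≤ K ^ 2 * ((F y + F x) * ((1 + |x - y|) ^ 2)⁻¹) := by
        apply mul_le_mul_of_nonneg_left _ (by positivity)
        exact le_mul_of_one_le_left (by positivity) hFS
  · push Not at hxy
    have hx : φ x = 0 := image_eq_zero_of_notMem_tsupport hxy.1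
    have hy : φ y = 0 := image_eq_zero_of_notMem_tsupport hxy.2
    simp only [hx, hy, sub_self, zero_div]
    have := hF0 x
    have := hF0 y
    rw [zero_pow two_ne_zero]
    positivity

theorem testL2_mem_HHalf (φ : 𝓓(halfLine, ℝ)) : testL2 φ ∈ HHalf :=
  (memLp_congr_ae (diffQuot_congr (testL2_ae φ))).2 (diffQuot_testFunction_memLp φ)

theorem weighted_testFunction_memLp (φ : 𝓓(halfLine, ℝ)) : MemLp (weighted φ) 2 vol := by
  have hc : Continuous (weighted φ) := by
    rw [continuous_iff_continuousAt]
    intro t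
    by_cases ht : t ∈ tsupport φ
    · have ht0 : 0 < t := φ.tsupport_subset ht
      have hts : tstar = fun s => min s 1 := by
        funext s
        simp only [tstar, min_def]
      refine ContinuousAt.mul ?_ φ.continuous.continuousAt
      rw [hts]
      refine ContinuousAt.rpow_const (by fun_prop) (Or.inl ?_)
      exact (lt_min ht0 one_pos).ne'
    · have h0 : φ =ᶠ[nhds t] 0 := notMem_tsupport_iff_eventuallyEq.1 ht
      have : weighted φ =ᶠ[nhds t] fun _ => 0 := by
        filter_upwards [h0] with s hs
        simp [weighted, hs]
      exact continuousAt_const.congr this.symm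
  have hs : HasCompactSupport (weighted φ) := φ.hasCompactSupport.mul_left
  exact (hc.memLp_of_hasCompactSupport hs).restrict _

theorem testL2_mem_HHalf00 (φ : 𝓓(halfLine, ℝ)) : testL2 φ ∈ HHalf00 :=
  ⟨testL2_mem_HHalf φ,
    (memLp_congr_ae (weighted_congr (testL2_ae φ))).2 (weighted_testFunction_memLp φ)⟩

/-- A test function as an element of `H^{1/2}(0, ∞)`. -/
def testHHalf (φ : 𝓓(halfLine, ℝ)) : HHalf := ⟨testL2 φ, testL2_mem_HHalf φ⟩

/-- A test function as an element of `H^{1/2}_{00}(0, ∞)`. -/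
def testHHalf00 (φ : 𝓓(halfLine, ℝ)) : HHalf00 := ⟨testL2 φ, testL2_mem_HHalf00 φ⟩

/-- The bilinear form `B` is bounded on `H^{1/2}_{00} × H^{1/2}`. -/
def IsBoundedForm (B : HHalf00 →ₗ[ℝ] HHalf →ₗ[ℝ] ℝ) : Prop :=
  ∃ C : ℝ, ∀ (f : HHalf00) (g : HHalf), |B f g| ≤ C * normHHalf00 f * normHHalf g

/-- The bilinear form `B` extends `(f, g) ↦ ∫ f' g` from pairs of test functions. -/
def ExtendsPairing (B : HHalf00 →ₗ[ℝ] HHalf →ₗ[ℝ] ℝ) : Prop :=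
  ∀ φ ψ : 𝓓(halfLine, ℝ),
    B (testHHalf00 φ) (testHHalf ψ) = ∫ t in Ioi (0 : ℝ), deriv φ t * ψ t

end HalfLine

end

/-!
The form is written down explicitly, and test functions are shown to be dense in both spaces; together
these give every claim.

*The form.* Extend `f` by zero and reflect `g` evenly to the line. Reflection is bounded for the
Gagliardo seminorm (`lintegral_diffQuot_even_le`), and extension by zero costs only the Hardy term
`∫ f² / t` from the norm of `H^{1/2}_{00}` (`lintegral_diffQuot_zeroExtension_le`). On the line put
`T(f, g) = ∬ (f(x) - f(x + h)) (g(x + h) - g(x + 2h)) / (h |h|) dx dh` (`lineForm`). Since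
`(x, y) ↦ (y, 2y - x)` preserves the measure of the plane, the Cauchy-Schwarz inequality bounds `T` by
the product of the Gagliardo seminorms. For smooth `f` and `g`, with correlation
`c(t) = ∫ f(x) g(x + t) dx` and `o(t) = c(t) - c(-t)`, the integral over `x` leaves the Frullani
integral `T(f, g) = ∫_0^∞ (2 o(h) - o(2h)) / h² dh = 2 log 2 · o'(0) = 4 log 2 · ∫ f g'`
(`integral_frullani`, `lineForm_eq`). So `-T / (4 log 2)` extends `∫ f' g`.

*Density.* Both norms are graph norms of `f ↦ (W f, (f(x) - f(y)) / |x - y|)` for a weight `W`. A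
sequence bounded in such a norm and convergent almost everywhere converges weakly, so its limit stays
in the closure of a subspace (`Approximable.of_ae_tendsto`), and every approximation step needs only
uniform bounds. Truncation decreases the norm. Cutting off a bounded function near `0` and `∞` by
dilates of one fixed function is bounded because the seminorm is invariant under dilations; this is
where the exponent `1/2` enters. Mollification is bounded by Jensen's inequality.

*Conclusion.* A functional that is bounded in the norm and vanishes on test functions is zero
(`HHalf.functional_ext`, `HHalf00.functional_ext`). Uniqueness and the formulas with weak derivatives
follow by testing first one variable and then the other.
-/

noncomputable section

namespace HalfLine

open Filter Topology

/-! ### Weak convergence in `L²` -/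

section L2Generic

variable {X : Type*} [MeasurableSpace X] {μ : Measure X}

theorem eLpNorm_two_toReal_sq {f : X → ℝ} (hf : MemLp f 2 μ) :
    (eLpNorm f 2 μ).toReal ^ 2 = ∫ x, f x ^ 2 ∂μ := by
  have h := L2.inner_def (𝕜 := ℝ) (hf.toLp f) (hf.toLp f)
  rw [real_inner_self_eq_norm_sq, Lp.norm_toLp] at h
  rw [h]
  refine integral_congr_ae ?_
  filter_upwards [hf.coeFn_toLp] with x hx
  simp [hx, sq]

theorem inner_toLp {f g : X → ℝ} (hf : MemLp f 2 μ) (hg : MemLp g 2 μ) :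
    inner ℝ (hf.toLp f) (hg.toLp g) = ∫ x, f x * g x ∂μ := by
  rw [L2.inner_def]
  refine integral_congr_ae ?_
  filter_upwards [hf.coeFn_toLp, hg.coeFn_toLp] with x hx hy
  simp [hx, hy, mul_comm]

theorem abs_integral_mul_le {f g : X → ℝ} (hf : MemLp f 2 μ) (hg : MemLp g 2 μ) :
    |∫ x, f x * g x ∂μ| ≤ (eLpNorm f 2 μ).toReal * (eLpNorm g 2 μ).toReal := by
  rw [← inner_toLp hf hg, ← Lp.norm_toLp f hf, ← Lp.norm_toLp g hg]
  exact abs_real_inner_le_norm _ _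

theorem integrable_mul_of_memLp {f g : X → ℝ} (hf : MemLp f 2 μ) (hg : MemLp g 2 μ) :
    Integrable (fun x => f x * g x) μ := hf.integrable_mul hg

/-- A bounded sequence in `L²` that tends to zero almost everywhere tends to zero weakly.
The pointwise bound `|w d| ≤ (|w| + |d|) min(|w|, |d|)` splits off the factor
`min(|w|, |d|)`, which is dominated by `|w|` and hence small in `L²`. -/
theorem tendsto_integral_mul_zero_of_ae_tendsto {d : ℕ → X → ℝ} {w : X → ℝ} {C : ℝ≥0∞}
    (hC : C ≠ ∞) (hd : ∀ n, MemLp (d n) 2 μ) (hdC : ∀ n, eLpNorm (d n) 2 μ ≤ C)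
    (hw : MemLp w 2 μ) (hlim : ∀ᵐ x ∂μ, Tendsto (fun n => d n x) atTop (𝓝 0)) :
    Tendsto (fun n => ∫ x, w x * d n x ∂μ) atTop (𝓝 0) := by
  set m : ℕ → X → ℝ := fun n x => min |w x| |d n x| with hm
  have hmeas : ∀ n, AEStronglyMeasurable (m n) μ := fun n =>
    hw.1.norm.inf (hd n).1.norm
  have hmL : ∀ n, MemLp (m n) 2 μ := fun n => hw.mono (hmeas n) <| Eventually.of_forall fun x => by
    simp only [hm, Real.norm_eq_abs]
    rw [abs_of_nonneg (le_min (abs_nonneg _) (abs_nonneg _))]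
    exact min_le_left _ _
  have hm0 : Tendsto (fun n => ∫ x, m n x ^ 2 ∂μ) atTop (𝓝 0) := by
    have : (0 : ℝ) = ∫ x, (0 : ℝ) ∂μ := by simp
    rw [this]
    refine tendsto_integral_of_dominated_convergence (fun x => w x ^ 2)
      (fun n => (hmeas n).pow 2) hw.integrable_sq ?_ ?_
    · refine fun n => Eventually.of_forall fun x => ?_
      have h0 : 0 ≤ m n x := le_min (abs_nonneg _) (abs_nonneg _)
      rw [Real.norm_eq_abs, abs_of_nonneg (sq_nonneg _), ← sq_abs (w x)]
      exact pow_le_pow_left₀ h0 (min_le_left _ _) 2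
    · filter_upwards [hlim] with x hx
      have h1 : Tendsto (fun n => m n x) atTop (𝓝 (min |w x| |0|)) :=
        tendsto_const_nhds.min hx.abs
      simpa using h1.pow 2
  have hm1 : Tendsto (fun n => (eLpNorm (m n) 2 μ).toReal) atTop (𝓝 0) := by
    have h : ∀ n, (eLpNorm (m n) 2 μ).toReal = Real.sqrt (∫ x, m n x ^ 2 ∂μ) := fun n => by
      rw [← eLpNorm_two_toReal_sq (hmL n), Real.sqrt_sq ENNReal.toReal_nonneg]
    simp only [h]
    simpa using hm0.sqrt
  set D : ℝ := (eLpNorm w 2 μ + C).toReal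
  have hbound : ∀ n, |∫ x, w x * d n x ∂μ| ≤ D * (eLpNorm (m n) 2 μ).toReal := by
    intro n
    have hs : MemLp (fun x => |w x| + |d n x|) 2 μ := hw.norm.add (hd n).norm
    have hsD : (eLpNorm (fun x => |w x| + |d n x|) 2 μ).toReal ≤ D := by
      refine ENNReal.toReal_mono (ENNReal.add_ne_top.2 ⟨hw.2.ne, hC⟩) ?_
      refine (eLpNorm_add_le hw.norm.1 (hd n).norm.1 (by norm_num)).trans ?_
      rw [eLpNorm_norm, eLpNorm_norm]
      gcongr
      exact hdC n
    calc |∫ x, w x * d n x ∂μ| ≤ ∫ x, |w x * d n x| ∂μ := abs_integral_le_integral_abs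
      _ ≤ ∫ x, (|w x| + |d n x|) * m n x ∂μ := by
          refine integral_mono (hw.integrable_mul (hd n)).abs (hs.integrable_mul (hmL n)) ?_
          intro x
          simp only [hm, abs_mul]
          rcases le_total |w x| |d n x| with h | h
          · rw [min_eq_left h]; nlinarith [abs_nonneg (w x), abs_nonneg (d n x)]
          · rw [min_eq_right h]; nlinarith [abs_nonneg (w x), abs_nonneg (d n x)]
      _ ≤ _ := (le_abs_self _).trans (abs_integral_mul_le hs (hmL n))
      _ ≤ _ := by gcongr
  refine squeeze_zero_norm hbound ?_
  simpa using hm1.const_mul D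

theorem tendsto_integral_mul_of_ae_tendsto {h : ℕ → X → ℝ} {k w : X → ℝ} {C : ℝ≥0∞}
    (hC : C ≠ ∞) (hh : ∀ n, MemLp (h n) 2 μ) (hhC : ∀ n, eLpNorm (h n) 2 μ ≤ C)
    (hk : MemLp k 2 μ) (hw : MemLp w 2 μ)
    (hlim : ∀ᵐ x ∂μ, Tendsto (fun n => h n x) atTop (𝓝 (k x))) :
    Tendsto (fun n => ∫ x, w x * h n x ∂μ) atTop (𝓝 (∫ x, w x * k x ∂μ)) := by
  have key := tendsto_integral_mul_zero_of_ae_tendsto (d := fun n x => h n x - k x)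
    (C := C + eLpNorm k 2 μ) (ENNReal.add_ne_top.2 ⟨hC, hk.2.ne⟩) (fun n => (hh n).sub hk)
    (fun n => (eLpNorm_sub_le (hh n).1 hk.1 (by norm_num)).trans (by gcongr; exact hhC n)) hw
    (by filter_upwards [hlim] with x hx; simpa using hx.sub_const (k x))
  have h2 : ∀ n, ∫ x, w x * h n x ∂μ = (∫ x, w x * (h n x - k x) ∂μ) + ∫ x, w x * k x ∂μ := by
    intro n
    have hd : MemLp (fun x => h n x - k x) 2 μ := (hh n).sub hk
    rw [← integral_add (integrable_mul_of_memLp hw hd) (integrable_mul_of_memLp hw hk)]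
    refine integral_congr_ae (Eventually.of_forall fun x => ?_)
    simp only []
    ring
  simp only [h2]
  simpa using key.add_const (∫ x, w x * k x ∂μ)

end L2Generic

/-! ### Graph norms and the closure of the test functions -/

theorem diffQuot_add (f g : ℝ → ℝ) : diffQuot (f + g) = diffQuot f + diffQuot g := by
  funext p
  simp only [diffQuot, Pi.add_apply]
  ring

theorem diffQuot_smul (c : ℝ) (f : ℝ → ℝ) : diffQuot (c • f) = c • diffQuot f := by
  funext p
  simp only [diffQuot, Pi.smul_apply, smul_eq_mul]
  ring

theorem diffQuot_zero : diffQuot 0 = 0 := by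
  funext p
  simp [diffQuot]

/-- The functions with `W f ∈ L²(0, ∞)` and finite Gagliardo seminorm on the half-line. The weight
`W = 1` gives `H^{1/2}`, the weight `W = (1 + 1 / t*)^{1/2}` gives `H^{1/2}_{00}`. -/
def weightedSpace (W : ℝ → ℝ) : Submodule ℝ (ℝ → ℝ) where
  carrier := {f | MemLp (fun t => W t * f t) 2 vol ∧ MemLp (diffQuot f) 2 (vol.prod vol)}
  zero_mem' := by
    refine ⟨?_, ?_⟩
    · simp
    · rw [diffQuot_zero]
      exact MemLp.zero
  add_mem' := by
    intro f g hf hg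
    refine ⟨?_, ?_⟩
    · convert hf.1.add hg.1 using 1
      funext t
      simp only [Pi.add_apply]
      ring
    · rw [diffQuot_add]
      exact hf.2.add hg.2
  smul_mem' := by
    intro c f hf
    refine ⟨?_, ?_⟩
    · convert hf.1.const_smul c using 1
      funext t
      simp only [Pi.smul_apply, smul_eq_mul]
      ring
    · rw [diffQuot_smul]
      exact hf.2.const_smul c

/-- The Hilbert space `L²(0, ∞) ⊕ L²((0, ∞)²)`. -/
abbrev GraphSpace : Type := WithLp 2 (Lp ℝ 2 vol × Lp ℝ 2 (vol.prod vol))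

/-- The map `f ↦ (W f, (f x - f y) / |x - y|)`, through which norms of Sobolev type become Hilbert
space norms. -/
def graphMap (W : ℝ → ℝ) : weightedSpace W →ₗ[ℝ] GraphSpace where
  toFun f := WithLp.toLp 2 (f.2.1.toLp _, f.2.2.toLp _)
  map_add' f g := by
    rw [← WithLp.toLp_add, Prod.mk_add_mk, ← MemLp.toLp_add, ← MemLp.toLp_add]
    congr 2
    · refine MemLp.toLp_congr _ _ (Eventually.of_forall fun t => ?_)
      simp only [Submodule.coe_add, Pi.add_apply]
      ring
    · refine MemLp.toLp_congr _ _ (Eventually.of_forall fun t => ?_)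
      simp only [Submodule.coe_add, diffQuot_add]
  map_smul' c f := by
    rw [RingHom.id_apply, ← WithLp.toLp_smul, Prod.smul_mk, ← MemLp.toLp_const_smul,
      ← MemLp.toLp_const_smul]
    congr 2
    · refine MemLp.toLp_congr _ _ (Eventually.of_forall fun t => ?_)
      simp only [Submodule.coe_smul, Pi.smul_apply, smul_eq_mul]
      ring
    · refine MemLp.toLp_congr _ _ (Eventually.of_forall fun t => ?_)
      simp only [Submodule.coe_smul, diffQuot_smul]

theorem norm_graphMap_sq (W : ℝ → ℝ) (f : weightedSpace W) :
    ‖graphMap W f‖ ^ 2 =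
      (∫ t, (W t * (f : ℝ → ℝ) t) ^ 2 ∂vol) + ∫ p, diffQuot f p ^ 2 ∂(vol.prod vol) := by
  rw [WithLp.prod_norm_sq_eq_of_L2, ← eLpNorm_two_toReal_sq f.2.1, ← eLpNorm_two_toReal_sq f.2.2,
    ← Lp.norm_toLp _ f.2.1, ← Lp.norm_toLp _ f.2.2]
  rfl

/-- The closure of the test functions with respect to the norm given by the weight `W`, as a subspace
of the graph space. -/
def testClosure (W : ℝ → ℝ) : Submodule ℝ GraphSpace :=
  (Submodule.span ℝ (graphMap W '' {f | ∃ φ : 𝓓(halfLine, ℝ), φ = (f : ℝ → ℝ)})).topologicalClosure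

/-- `f` is a limit of test functions in the norm given by the weight `W`. -/
def Approximable (W f : ℝ → ℝ) : Prop :=
  ∃ h : f ∈ weightedSpace W, graphMap W ⟨f, h⟩ ∈ testClosure W

theorem approximable_testFunction {W : ℝ → ℝ} (φ : 𝓓(halfLine, ℝ))
    (h : (φ : ℝ → ℝ) ∈ weightedSpace W) : Approximable W φ :=
  ⟨h, Submodule.le_topologicalClosure _ (Submodule.subset_span ⟨⟨φ, h⟩, ⟨φ, rfl⟩, rfl⟩)⟩

theorem ae_fst_snd {μ : Measure ℝ} [SFinite μ] {P : ℝ → Prop} (h : ∀ᵐ x ∂μ, P x) :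
    ∀ᵐ p ∂(μ.prod μ), P p.1 ∧ P p.2 := by
  have h1 := (Measure.quasiMeasurePreserving_fst (μ := μ) (ν := μ)).ae h
  have h2 := (Measure.quasiMeasurePreserving_snd (μ := μ) (ν := μ)).ae h
  filter_upwards [h1, h2] with p hp1 hp2 using ⟨hp1, hp2⟩

/-- A bounded sequence of approximable functions that converges almost everywhere has an approximable
limit: it converges weakly in the graph space, and closed subspaces are weakly closed. -/
theorem Approximable.of_ae_tendsto {W f : ℝ → ℝ} {u : ℕ → ℝ → ℝ} {C : ℝ≥0∞} (hC : C ≠ ∞)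
    (hu : ∀ n, Approximable W (u n))
    (h1 : ∀ n, eLpNorm (fun t => W t * u n t) 2 vol ≤ C)
    (h2 : ∀ n, eLpNorm (diffQuot (u n)) 2 (vol.prod vol) ≤ C)
    (hf : f ∈ weightedSpace W)
    (hlim : ∀ᵐ t ∂vol, Tendsto (fun n => u n t) atTop (𝓝 (f t))) :
    Approximable W f := by
  refine ⟨hf, ?_⟩
  have hcl : (testClosure W).topologicalClosure = testClosure W :=
    (Submodule.isClosed_topologicalClosure _).submodule_topologicalClosure_eq
  rw [← hcl, ← Submodule.orthogonal_orthogonal_eq_closure, Submodule.mem_orthogonal]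
  intro w hw
  have hinner : ∀ (g : ℝ → ℝ) (hg : g ∈ weightedSpace W), inner ℝ w (graphMap W ⟨g, hg⟩) =
      (∫ t, w.fst t * (W t * g t) ∂vol) + ∫ p, w.snd p * diffQuot g p ∂(vol.prod vol) := by
    intro g hg
    rw [WithLp.prod_inner_apply, ← inner_toLp (Lp.memLp w.fst) hg.1,
      ← inner_toLp (Lp.memLp w.snd) hg.2, Lp.toLp_coeFn, Lp.toLp_coeFn]
    rfl
  have h0 : ∀ n, inner ℝ w (graphMap W ⟨u n, (hu n).1⟩) = 0 := fun n =>
    (Submodule.mem_orthogonal' _ _).1 hw _ (hu n).2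
  simp only [hinner] at h0
  rw [hinner]
  have t1 := tendsto_integral_mul_of_ae_tendsto hC (fun n => (hu n).1.1) h1 hf.1 (Lp.memLp w.fst)
    (by filter_upwards [hlim] with t ht using ht.const_mul (W t))
  have t2 := tendsto_integral_mul_of_ae_tendsto hC (fun n => (hu n).1.2) h2 hf.2 (Lp.memLp w.snd)
    (by
      filter_upwards [ae_fst_snd hlim] with p hp
      exact (hp.1.sub hp.2).div_const _)
  have t := t1.add t2
  simp only [h0] at t
  exact (tendsto_nhds_unique t tendsto_const_nhds)

/-! ### Extension to the line -/

theorem eLpNorm_two_sq {X : Type*} [MeasurableSpace X] {μ : Measure X} (f : X → ℝ) :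
    eLpNorm f 2 μ ^ 2 = ∫⁻ x, ‖f x‖ₑ ^ 2 ∂μ := by
  have h := eLpNorm_nnreal_pow_eq_lintegral (f := f) (μ := μ) (p := 2) two_ne_zero
  simpa using h

theorem measurable_diffQuot {f : ℝ → ℝ} (hf : Measurable f) : Measurable (diffQuot f) := by
  unfold diffQuot
  fun_prop

theorem lintegral_Iic_comp_neg {F : ℝ → ℝ≥0∞} (hF : Measurable F) :
    ∫⁻ x in Iic 0, F (-x) = ∫⁻ x in Ioi 0, F x := by
  rw [← setLIntegral_congr (Iio_ae_eq_Iic (a := (0 : ℝ)) (μ := volume)),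
    ← (Measure.measurePreserving_neg (volume : Measure ℝ)).setLIntegral_comp_preimage
      measurableSet_Ioi hF]
  simp

theorem lintegral_comp_abs {F : ℝ → ℝ≥0∞} (hF : Measurable F) :
    ∫⁻ x, F |x| = 2 * ∫⁻ x in Ioi 0, F x := by
  rw [← lintegral_add_compl _ (measurableSet_Ioi (a := (0 : ℝ))), compl_Ioi, two_mul]
  congr 1
  · refine setLIntegral_congr_fun measurableSet_Ioi fun x hx => ?_
    simp only [abs_of_pos (mem_Ioi.1 hx)]
  · rw [← lintegral_Iic_comp_neg hF]
    refine setLIntegral_congr_fun measurableSet_Iic fun x hx => ?_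
    simp only [abs_of_nonpos (mem_Iic.1 hx)]

/-- Even reflection is bounded for the Gagliardo seminorm, because `||x| - |y|| ≤ |x - y|`. -/
theorem lintegral_diffQuot_even_le {g : ℝ → ℝ} (hg : Measurable g) :
    ∫⁻ p, ‖diffQuot (fun x => g |x|) p‖ₑ ^ 2 ≤
      4 * ∫⁻ p, ‖diffQuot g p‖ₑ ^ 2 ∂(vol.prod vol) := by
  have hm : Measurable fun p => ‖diffQuot g p‖ₑ ^ 2 := (measurable_diffQuot hg).enorm.pow_const 2
  calc ∫⁻ p, ‖diffQuot (fun x => g |x|) p‖ₑ ^ 2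
      ≤ ∫⁻ p : ℝ × ℝ, ‖diffQuot g (|p.1|, |p.2|)‖ₑ ^ 2 := by
        refine lintegral_mono fun p => pow_le_pow_left' (enorm_le_iff_norm_le.2 ?_) 2
        obtain ⟨x, y⟩ := p
        simp only [diffQuot, norm_div, Real.norm_eq_abs, abs_abs]
        rcases eq_or_ne |x| |y| with h | h
        · simp [h]
        · exact div_le_div_of_nonneg_left (abs_nonneg _) (abs_pos.2 (sub_ne_zero.2 h))
            (abs_abs_sub_abs_le x y)
    _ = ∫⁻ x, ∫⁻ y, ‖diffQuot g (|x|, |y|)‖ₑ ^ 2 := by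
        rw [Measure.volume_eq_prod, lintegral_prod]
        exact (hm.comp (f := fun p : ℝ × ℝ => (|p.1|, |p.2|)) (by fun_prop)).aemeasurable
    _ = ∫⁻ x, 2 * ∫⁻ y in Ioi 0, ‖diffQuot g (|x|, y)‖ₑ ^ 2 := by
        refine lintegral_congr fun x => ?_
        exact lintegral_comp_abs (F := fun y => ‖diffQuot g (|x|, y)‖ₑ ^ 2)
          (hm.comp measurable_prodMk_left)
    _ = 2 * ∫⁻ x, ∫⁻ y in Ioi 0, ‖diffQuot g (|x|, y)‖ₑ ^ 2 := by
        rw [lintegral_const_mul' _ _ (by norm_num)]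
    _ = 2 * (2 * ∫⁻ x in Ioi 0, ∫⁻ y in Ioi 0, ‖diffQuot g (x, y)‖ₑ ^ 2) := by
        congr 1
        exact lintegral_comp_abs (F := fun x => ∫⁻ y in Ioi 0, ‖diffQuot g (x, y)‖ₑ ^ 2)
          hm.lintegral_prod_right'
    _ = _ := by
        rw [lintegral_prod _ hm.aemeasurable, ← mul_assoc]
        norm_num

theorem lintegral_Iic_inv_sq {y : ℝ} (hy : 0 < y) :
    ∫⁻ x in Iic 0, ENNReal.ofReal (((y - x) ^ 2)⁻¹) = ENNReal.ofReal y⁻¹ := by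
  have h1 := lintegral_Iic_comp_neg (F := fun x => ENNReal.ofReal (((y + x) ^ 2)⁻¹)) (by fun_prop)
  simp only [← sub_eq_add_neg] at h1
  rw [h1]
  have hderiv : ∀ x ∈ Ioi (0 : ℝ), HasDerivAt (fun x => (y + x)⁻¹) (-((y + x) ^ 2)⁻¹) x := by
    intro x hx
    have hx0 : y + x ≠ 0 := (add_pos hy hx).ne'
    have h := ((hasDerivAt_id' x).const_add y).fun_inv hx0
    rwa [neg_div, one_div] at h
  have hcont : ContinuousWithinAt (fun x => (y + x)⁻¹) (Ici 0) 0 :=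
    ContinuousAt.continuousWithinAt (ContinuousAt.inv₀ (by fun_prop) (by simpa using hy.ne'))
  have hneg : ∀ x ∈ Ioi (0 : ℝ), -((y + x) ^ 2)⁻¹ ≤ 0 := fun x _ => by
    simp only [Left.neg_nonpos_iff]
    positivity
  have hlim : Tendsto (fun x => (y + x)⁻¹) atTop (𝓝 0) :=
    tendsto_inv_atTop_zero.comp (tendsto_atTop_add_const_left _ _ tendsto_id)
  have hint := integrableOn_Ioi_deriv_of_nonpos hcont hderiv hneg hlim
  have hval := integral_Ioi_of_hasDerivAt_of_nonpos hcont hderiv hneg hlim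
  rw [integral_neg] at hval
  have hint' : IntegrableOn (fun x => ((y + x) ^ 2)⁻¹) (Ioi 0) := by simpa using hint.neg
  rw [← ofReal_integral_eq_lintegral_ofReal hint' (Eventually.of_forall fun x => by positivity)]
  congr 1
  simp at hval
  linarith

/-- The Gagliardo seminorm of an extension by zero: the interaction of the two half-lines amounts to
the Hardy term `∫ f² / t`. -/
theorem lintegral_diffQuot_zeroExtension_le {f : ℝ → ℝ} (hf : Measurable f)
    (h0 : ∀ x ≤ 0, f x = 0) :
    ∫⁻ p, ‖diffQuot f p‖ₑ ^ 2 ≤ (∫⁻ p, ‖diffQuot f p‖ₑ ^ 2 ∂(vol.prod vol)) +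
      2 * ∫⁻ t in Ioi 0, ENNReal.ofReal t⁻¹ * ‖f t‖ₑ ^ 2 := by
  set A : ℝ × ℝ → ℝ≥0∞ := (Iic (0 : ℝ) ×ˢ Ioi (0 : ℝ)).indicator
    fun p => ENNReal.ofReal (((p.2 - p.1) ^ 2)⁻¹) * ‖f p.2‖ₑ ^ 2 with hA
  have hAm : Measurable A := by
    refine Measurable.indicator ?_ (measurableSet_Iic.prod measurableSet_Ioi)
    have : Measurable fun p : ℝ × ℝ => ‖f p.2‖ₑ ^ 2 := ((hf.comp measurable_snd).enorm).pow_const 2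
    refine Measurable.mul ?_ this
    fun_prop
  have hAint : ∫⁻ p, A p = ∫⁻ t in Ioi 0, ENNReal.ofReal t⁻¹ * ‖f t‖ₑ ^ 2 := by
    rw [Measure.volume_eq_prod, lintegral_prod_symm' _ hAm,
      ← lintegral_indicator measurableSet_Ioi]
    refine lintegral_congr fun y => ?_
    by_cases hy : y ∈ Ioi (0 : ℝ)
    · rw [indicator_of_mem hy, ← lintegral_Iic_inv_sq hy,
        ← lintegral_mul_const' _ _ (by finiteness), ← lintegral_indicator measurableSet_Iic]
      refine lintegral_congr fun x => ?_
      by_cases hx : x ∈ Iic (0 : ℝ)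
      · rw [indicator_of_mem hx, hA, indicator_of_mem (mk_mem_prod hx hy)]
      · rw [indicator_of_notMem hx, hA, indicator_of_notMem (fun h => hx h.1)]
    · rw [indicator_of_notMem hy]
      simp only [hA]
      rw [← lintegral_zero (μ := (volume : Measure ℝ))]
      refine lintegral_congr fun x => ?_
      rw [indicator_of_notMem (fun h => hy h.2)]
  have hQ : MeasurableSet (Ioi (0 : ℝ) ×ˢ Ioi (0 : ℝ)) := measurableSet_Ioi.prod measurableSet_Ioi
  rw [← lintegral_add_compl _ hQ, Measure.prod_restrict, ← Measure.volume_eq_prod]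
  gcongr
  calc ∫⁻ p in (Ioi (0 : ℝ) ×ˢ Ioi (0 : ℝ))ᶜ, ‖diffQuot f p‖ₑ ^ 2
      ≤ ∫⁻ p in (Ioi (0 : ℝ) ×ˢ Ioi (0 : ℝ))ᶜ, (A p + A p.swap) := by
        refine setLIntegral_mono' hQ.compl fun p hp => ?_
        obtain ⟨x, y⟩ := p
        have key : ∀ a b : ℝ, a ≤ 0 → 0 < b → ‖(0 - f b) / |a - b|‖ₑ ^ 2 ≤ A (a, b) := by
          intro a b ha hb
          rw [hA, indicator_of_mem (show (a, b) ∈ Iic (0 : ℝ) ×ˢ Ioi (0 : ℝ) from ⟨ha, hb⟩)]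
          have hab : 0 < |a - b| := abs_pos.2 (by linarith)
          rw [zero_sub, div_eq_mul_inv, enorm_mul, enorm_neg, mul_pow, mul_comm]
          gcongr
          rw [← ofReal_norm, ← ENNReal.ofReal_pow (norm_nonneg _)]
          apply ENNReal.ofReal_le_ofReal
          rw [Real.norm_eq_abs, abs_inv, abs_abs, inv_pow, sq_abs]
          simp only
          rw [← neg_sub b a, neg_sq]
        by_cases hx : 0 < x
        · have hy : y ≤ 0 := not_lt.1 fun h => hp ⟨hx, h⟩
          have h := key y x hy hx
          simp only [diffQuot, h0 y hy, Prod.swap_prod_mk]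
          refine le_trans (le_of_eq ?_) (h.trans le_add_self)
          rw [sub_zero, zero_sub, neg_div, enorm_neg, abs_sub_comm]
        · have hx' := not_lt.1 hx
          simp only [diffQuot, h0 x hx', Prod.swap_prod_mk]
          by_cases hy : 0 < y
          · exact (key x y hx' hy).trans le_self_add
          · simp [h0 y (not_lt.1 hy)]
    _ ≤ ∫⁻ p, (A p + A p.swap) := setLIntegral_le_lintegral _ _
    _ = (∫⁻ p, A p) + ∫⁻ p : ℝ × ℝ, A p.swap := lintegral_add_left hAm _
    _ = _ := by
        have hsw : ∫⁻ p : ℝ × ℝ, A p.swap = ∫⁻ p, A p := by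
          rw [Measure.volume_eq_prod]
          exact lintegral_prod_swap A
        rw [hsw, hAint, two_mul]

/-! ### Mollification -/

/-- Averages of translates do not increase the Gagliardo seminorm on the line (Jensen). -/
theorem lintegral_diffQuot_average_le {f : ℝ → ℝ} (hf : Measurable f) {N : ℝ}
    (hN : ∀ x, |f x| ≤ N) (π : Measure ℝ) [IsProbabilityMeasure π] :
    ∫⁻ p, ‖diffQuot (fun x => ∫ s, f (x - s) ∂π) p‖ₑ ^ 2 ≤ ∫⁻ p, ‖diffQuot f p‖ₑ ^ 2 := by
  have hint : ∀ x, Integrable (fun s => f (x - s)) π := fun x =>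
    Integrable.of_bound (hf.comp (measurable_const.sub measurable_id)).aestronglyMeasurable N
      (Eventually.of_forall fun s => hN _)
  have hm := measurable_diffQuot hf
  have hm2 : Measurable fun q : (ℝ × ℝ) × ℝ => diffQuot f (q.1 - (q.2, q.2)) :=
    hm.comp (by fun_prop)
  calc ∫⁻ p, ‖diffQuot (fun x => ∫ s, f (x - s) ∂π) p‖ₑ ^ 2
      ≤ ∫⁻ p : ℝ × ℝ, ∫⁻ s, ‖diffQuot f (p - (s, s))‖ₑ ^ 2 ∂π := by
        refine lintegral_mono fun p => ?_
        have h1 : diffQuot (fun x => ∫ s, f (x - s) ∂π) p = ∫ s, diffQuot f (p - (s, s)) ∂π := by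
          simp only [diffQuot, Prod.fst_sub, Prod.snd_sub, sub_sub_sub_cancel_right]
          rw [integral_div, integral_sub (hint _) (hint _)]
        have h2 : Measurable fun s : ℝ => diffQuot f (p - (s, s)) :=
          hm2.comp measurable_prodMk_left
        simp only [h1]
        rw [← eLpNorm_two_sq]
        refine pow_le_pow_left' ?_ 2
        refine (enorm_integral_le_lintegral_enorm _).trans ?_
        rw [← eLpNorm_one_eq_lintegral_enorm]
        exact eLpNorm_le_eLpNorm_of_exponent_le (by norm_num) h2.aestronglyMeasurable
    _ = ∫⁻ s, (∫⁻ p : ℝ × ℝ, ‖diffQuot f (p - (s, s))‖ₑ ^ 2) ∂π := by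
        rw [lintegral_lintegral_swap]
        exact (hm2.enorm.pow_const 2).aemeasurable
    _ = ∫⁻ s, (∫⁻ p : ℝ × ℝ, ‖diffQuot f p‖ₑ ^ 2) ∂π := by
        refine lintegral_congr fun s => ?_
        exact lintegral_sub_right_eq_self (fun p => ‖diffQuot f p‖ₑ ^ 2) (s, s)
    _ = _ := by simp

/-- The weights admitted below: measurable and bounded away from the origin. -/
structure IsTameWeight (W : ℝ → ℝ) : Prop where
  measurable : Measurable W
  bounded : ∀ a > 0, ∃ M, ∀ t ≥ a, |W t| ≤ M

theorem eLpNorm_weight_mul_le {W f : ℝ → ℝ} {a b M N : ℝ} (hM : ∀ t ≥ a, |W t| ≤ M)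
    (hN : ∀ x, |f x| ≤ N) (hf0 : ∀ x, x ∉ Icc a b → f x = 0) :
    eLpNorm (fun t => W t * f t) 2 vol ≤
      eLpNorm ((Icc a b).indicator fun _ => M * N) 2 vol := by
  refine eLpNorm_mono fun t => ?_
  by_cases ht : t ∈ Icc a b
  · rw [indicator_of_mem ht, norm_mul, norm_mul]
    simp only [Real.norm_eq_abs]
    exact mul_le_mul ((hM t ht.1).trans (le_abs_self _)) ((hN t).trans (le_abs_self _))
      (abs_nonneg _) (abs_nonneg _)
  · simp [hf0 t ht]

theorem memLp_indicator_Icc (a b c : ℝ) : MemLp ((Icc a b).indicator fun _ => c) 2 vol :=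
  memLp_indicator_const 2 measurableSet_Icc c
    (Or.inr ((Measure.restrict_apply_le _ _).trans_lt measure_Icc_lt_top).ne)

theorem memLp_diffQuot_restrict {f : ℝ → ℝ} (hf : Measurable f) {C : ℝ≥0∞} (hC : C ≠ ∞)
    (h : ∫⁻ p, ‖diffQuot f p‖ₑ ^ 2 ≤ C ^ 2) :
    MemLp (diffQuot f) 2 (vol.prod vol) ∧ eLpNorm (diffQuot f) 2 (vol.prod vol) ≤ C := by
  have h1 : eLpNorm (diffQuot f) 2 (vol.prod vol) ≤ C := by
    have h2 : eLpNorm (diffQuot f) 2 (vol.prod vol) ≤ eLpNorm (diffQuot f) 2 volume := by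
      rw [Measure.prod_restrict, Measure.volume_eq_prod]
      exact eLpNorm_mono_measure _ Measure.restrict_le_self
    refine h2.trans ?_
    rw [← eLpNorm_two_sq] at h
    exact (ENNReal.pow_le_pow_left_iff two_ne_zero).1 h
  exact ⟨⟨(measurable_diffQuot hf).aestronglyMeasurable, h1.trans_lt hC.lt_top⟩, h1⟩

/-- A bounded function of finite Gagliardo seminorm with compact support in `(0, ∞)` is a limit of its
mollifications, which are test functions. -/
theorem approximable_of_compact_support {W f : ℝ → ℝ} (hW : IsTameWeight W) (hf : Measurable f)
    {N a b : ℝ} (hN : ∀ x, |f x| ≤ N) (ha : 0 < a) (hf0 : ∀ x, x ∉ Icc a b → f x = 0)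
    (hq : MemLp (diffQuot f) 2 (vol.prod vol)) : Approximable W f := by
  obtain ⟨M, hM⟩ := hW.bounded (a / 2) (by positivity)
  have hfmem : f ∈ weightedSpace W := by
    refine ⟨⟨(hW.measurable.mul hf).aestronglyMeasurable, ?_⟩, hq⟩
    exact (eLpNorm_weight_mul_le (fun t ht => hM t (by linarith [ge_iff_le.1 ht])) hN
      hf0).trans_lt (memLp_indicator_Icc _ _ _).2
  -- the seminorm on the whole line is finite
  have hE : ∫⁻ p, ‖diffQuot f p‖ₑ ^ 2 < ∞ := by
    refine (lintegral_diffQuot_zeroExtension_le hf fun x hx => hf0 x fun h => ?_).trans_lt ?_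
    · linarith [h.1]
    · rw [← eLpNorm_two_sq]
      refine ENNReal.add_lt_top.2 ⟨ENNReal.pow_lt_top hq.2,
        ENNReal.mul_lt_top (by norm_num) ?_⟩
      calc ∫⁻ t in Ioi 0, ENNReal.ofReal t⁻¹ * ‖f t‖ₑ ^ 2
          ≤ ∫⁻ t, (Icc a b).indicator (fun _ => ENNReal.ofReal a⁻¹ * ENNReal.ofReal N ^ 2) t := by
            refine (setLIntegral_le_lintegral _ _).trans (lintegral_mono fun t => ?_)
            by_cases ht : t ∈ Icc a b
            · rw [indicator_of_mem ht, ← ofReal_norm]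
              have := ht.1
              gcongr
              exact hN t
            · simp [hf0 t ht]
        _ < ∞ := by
            rw [lintegral_indicator_const measurableSet_Icc]
            exact ENNReal.mul_lt_top (by finiteness) measure_Icc_lt_top
  have hfi : Integrable f := by
    have h1 : IntegrableOn f (Icc a b) :=
      Measure.integrableOn_of_bounded measure_Icc_lt_top.ne hf.aestronglyMeasurable
        (Eventually.of_forall hN)
    refine (integrableOn_iff_integrable_of_support_subset fun x hx => ?_).1 h1
    by_contra h
    exact hx (hf0 x h)
  set r : ℕ → ℝ := fun n => a / 4 * (1 / ((n : ℝ) + 1)) with hr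
  have hr0 : ∀ n, 0 < r n := fun n => by positivity
  set ρ : ℕ → ContDiffBump (0 : ℝ) := fun n =>
    ⟨r n, 2 * r n, hr0 n, by linarith [hr0 n]⟩ with hρ
  have hr1 : ∀ n, 2 * r n ≤ a / 2 := fun n => by
    have : 1 / ((n : ℝ) + 1) ≤ 1 := by
      rw [div_le_one (by positivity)]
      linarith [n.cast_nonneg (α := ℝ)]
    simp only [hr]
    nlinarith
  set u : ℕ → ℝ → ℝ := fun n =>
    convolution ((ρ n).normed volume) f (ContinuousLinearMap.lsmul ℝ ℝ) volume with hu
  have hu0 : ∀ n x, x ∉ Icc (a / 2) (b + a) → u n x = 0 := by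
    intro n x hx
    by_contra h
    obtain ⟨s, hs, t, ht, hst⟩ := Set.mem_add.1 (support_convolution_subset _ h)
    rw [ContDiffBump.support_normed_eq, Metric.mem_ball, Real.dist_eq, sub_zero, abs_lt] at hs
    have ht' : t ∈ Icc a b := by
      by_contra h'
      exact ht (hf0 t h')
    have := hr1 n
    have hs1 : -(2 * r n) < s := hs.1
    have hs2 : s < 2 * r n := hs.2
    exact hx ⟨by linarith [ht'.1], by linarith [ht'.2]⟩
  have hus : ∀ n, ContDiff ℝ ((⊤ : ℕ∞) : WithTop ℕ∞) (u n) := fun n =>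
    (ρ n).hasCompactSupport_normed.contDiff_convolution_left _ (ρ n).contDiff_normed
      hfi.locallyIntegrable
  have huc : ∀ n, HasCompactSupport (u n) := fun n => HasCompactSupport.intro isCompact_Icc (hu0 n)
  have hut : ∀ n, tsupport (u n) ⊆ halfLine := fun n => by
    have h1 : tsupport (u n) ⊆ Icc (a / 2) (b + a) := by
      refine closure_minimal (fun x hx => ?_) isClosed_Icc
      by_contra h
      exact hx (hu0 n x h)
    exact h1.trans fun x hx => lt_of_lt_of_le (by positivity) hx.1
  set φ : ℕ → 𝓓(halfLine, ℝ) := fun n => ⟨u n, hus n, huc n, hut n⟩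
  -- the mollifications are averages of translates with respect to probability measures
  set π : ℕ → Measure ℝ := fun n =>
    volume.withDensity fun s => ENNReal.ofReal ((ρ n).normed volume s) with hπ
  have hρm : ∀ n, Measurable ((ρ n).normed volume) := fun n => (ρ n).continuous_normed.measurable
  have hprob : ∀ n, IsProbabilityMeasure (π n) := fun n => ⟨by
    rw [hπ, withDensity_apply _ MeasurableSet.univ, setLIntegral_univ,
      ← ofReal_integral_eq_lintegral_ofReal (ρ n).integrable_normed
        (Eventually.of_forall (ρ n).nonneg_normed), (ρ n).integral_normed, ENNReal.ofReal_one]⟩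
  have hπu : ∀ n, u n = fun x => ∫ s, f (x - s) ∂(π n) := fun n => by
    funext x
    rw [hπ, integral_withDensity_eq_integral_toReal_smul (hρm n).ennreal_ofReal
      (Eventually.of_forall fun _ => ENNReal.ofReal_lt_top)]
    simp only [hu, convolution, ContinuousLinearMap.lsmul_apply]
    refine integral_congr_ae (Eventually.of_forall fun s => ?_)
    simp only [ENNReal.toReal_ofReal ((ρ n).nonneg_normed s)]
  have huN : ∀ n x, |u n x| ≤ N := fun n x => by
    rw [hπu, ← Real.norm_eq_abs]
    have := norm_integral_le_of_norm_le_const (μ := π n) (f := fun s => f (x - s)) (C := N)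
      (Eventually.of_forall fun s => hN _)
    simpa using this
  set C₁ := eLpNorm ((Icc (a / 2) (b + a)).indicator fun _ => M * N) 2 vol
  set C₂ : ℝ≥0∞ := eLpNorm (diffQuot f) 2 volume
  have hC₂ : C₂ ≠ ∞ := by
    intro h
    rw [← eLpNorm_two_sq] at hE
    change C₂ ^ 2 < ∞ at hE
    simp [h] at hE
  have hC₁ : C₁ ≠ ∞ := (memLp_indicator_Icc _ _ _).2.ne
  have hW1 : ∀ n, eLpNorm (fun t => W t * u n t) 2 vol ≤ C₁ := fun n =>
    eLpNorm_weight_mul_le hM (huN n) (hu0 n)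
  have hD : ∀ n, MemLp (diffQuot (u n)) 2 (vol.prod vol) ∧
      eLpNorm (diffQuot (u n)) 2 (vol.prod vol) ≤ C₂ := fun n => by
    refine memLp_diffQuot_restrict (hus n).continuous.measurable hC₂ ?_
    rw [eLpNorm_two_sq, hπu n]
    exact lintegral_diffQuot_average_le hf hN (π n)
  refine Approximable.of_ae_tendsto (u := u) (C := max C₁ C₂)
    (max_lt hC₁.lt_top hC₂.lt_top).ne (fun n => approximable_testFunction (φ n) ⟨?_, (hD n).1⟩)
    (fun n => (hW1 n).trans (le_max_left _ _)) (fun n => (hD n).2.trans (le_max_right _ _)) hfmem ?_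
  · exact ⟨(hW.measurable.mul (hus n).continuous.measurable).aestronglyMeasurable,
      (hW1 n).trans_lt hC₁.lt_top⟩
  · refine ae_restrict_of_ae ?_
    refine ContDiffBump.ae_convolution_tendsto_right_of_locallyIntegrable (K := 2) (φ := ρ) ?_
      (Eventually.of_forall fun n => le_rfl) hfi.locallyIntegrable
    have h := (tendsto_one_div_add_atTop_nhds_zero_nat (𝕜 := ℝ)).const_mul (2 * (a / 4))
    rw [mul_zero] at h
    refine h.congr fun n => ?_
    simp only [hρ, hr]
    ring

/-! ### Dilation invariance -/

/-- The Gagliardo seminorm of order `1/2` on the line is invariant under dilations. -/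
theorem eLpNorm_diffQuot_comp_mul {f : ℝ → ℝ} (hf : Measurable f) {c : ℝ} (hc : 0 < c) :
    eLpNorm (diffQuot fun x => f (c * x)) 2 volume = eLpNorm (diffQuot f) 2 volume := by
  have hF : Measurable fun p => ‖diffQuot f p‖ₑ ^ 2 := (measurable_diffQuot hf).enorm.pow_const 2
  have h1 : ∀ p, ‖diffQuot (fun x => f (c * x)) p‖ₑ ^ 2 =
      ENNReal.ofReal (c ^ 2) * ‖diffQuot f (c • p)‖ₑ ^ 2 := by
    intro p
    have h2 : diffQuot (fun x => f (c * x)) p = c * diffQuot f (c • p) := by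
      simp only [diffQuot, Prod.smul_fst, Prod.smul_snd, smul_eq_mul, ← mul_sub, abs_mul,
        abs_of_pos hc]
      rw [mul_div_assoc', mul_div_mul_left _ _ hc.ne']
    rw [h2, enorm_mul, mul_pow, Real.enorm_of_nonneg hc.le, ENNReal.ofReal_pow hc.le]
  have key : eLpNorm (diffQuot fun x => f (c * x)) 2 volume ^ 2 =
      eLpNorm (diffQuot f) 2 volume ^ 2 := by
    rw [eLpNorm_two_sq, eLpNorm_two_sq]
    simp only [h1]
    have hFc : Measurable fun p : ℝ × ℝ => ‖diffQuot f (c • p)‖ₑ ^ 2 :=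
      hF.comp (measurable_const_smul c)
    rw [lintegral_const_mul _ hFc, ← lintegral_map hF (measurable_const_smul c), Measure.map_addHaar_smul _ hc.ne',
      lintegral_smul_measure, smul_eq_mul, ← mul_assoc, ← ENNReal.ofReal_mul (by positivity)]
    have : c ^ 2 * |(c ^ Module.finrank ℝ (ℝ × ℝ))⁻¹| = 1 := by
      rw [Module.finrank_prod, Module.finrank_self, abs_of_pos (by positivity)]
      exact mul_inv_cancel₀ (by positivity)
    rw [this, ENNReal.ofReal_one, one_mul]
  exact (ENNReal.pow_right_strictMono two_ne_zero).injective key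

/-! ### Cutoff functions and density of test functions -/

/-- The piecewise linear function equal to `1` on `[-1, 1]` and to `0` off `[-2, 2]`. -/
def plateau (t : ℝ) : ℝ := max 0 (min 1 (2 - |t|))

theorem plateau_nonneg (t : ℝ) : 0 ≤ plateau t := le_max_left _ _

theorem plateau_le_one (t : ℝ) : plateau t ≤ 1 := max_le zero_le_one (min_le_left _ _)

theorem plateau_eq_one {t : ℝ} (h : |t| ≤ 1) : plateau t = 1 := by
  rw [plateau, min_eq_left (by linarith), max_eq_right zero_le_one]

theorem plateau_eq_zero {t : ℝ} (h : 2 ≤ |t|) : plateau t = 0 :=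
  max_eq_left ((min_le_right _ _).trans (by linarith))

theorem continuous_plateau : Continuous plateau := by
  unfold plateau
  fun_prop

theorem abs_plateau_sub_le (x y : ℝ) : |plateau x - plateau y| ≤ |x - y| := by
  unfold plateau
  rw [max_comm 0, max_comm 0]
  refine (abs_max_sub_max_le_abs _ _ _).trans ?_
  rw [min_comm 1, min_comm 1]
  refine (abs_min_sub_min_le_max _ _ _ _).trans (max_le ?_ (by simp))
  rw [sub_sub_sub_cancel_left, abs_sub_comm x y]
  exact abs_abs_sub_abs_le _ _

theorem memLp_diffQuot_plateau : MemLp (diffQuot plateau) 2 volume := by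
  have hmeas := measurable_diffQuot continuous_plateau.measurable
  rw [memLp_two_iff_integrable_sq hmeas.aestronglyMeasurable]
  set F : ℝ → ℝ := (Icc (-2 : ℝ) 2).indicator fun _ => 1
  set G : ℝ → ℝ := fun x => (1 + ‖x‖) ^ (-2 : ℝ)
  have hF : Integrable F volume :=
    (integrable_indicator_iff measurableSet_Icc).2 (integrableOn_const measure_Icc_lt_top.ne)
  have hG : Integrable G volume := integrable_one_add_norm (by simp)
  have hA : Integrable (fun p : ℝ × ℝ => F p.2 * G (p.1 - p.2)) (volume.prod volume) :=
    Integrable.convolution_integrand (ContinuousLinearMap.mul ℝ ℝ) hF hG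
  have hB : Integrable (fun p : ℝ × ℝ => F p.1 * G (p.2 - p.1)) (volume.prod volume) := hA.swap
  refine ((hA.add hB).const_mul (2 ^ 2)).mono' (hmeas.pow_const 2).aestronglyMeasurable
    (Eventually.of_forall fun p => ?_)
  obtain ⟨x, y⟩ := p
  have hF0 : ∀ z, 0 ≤ F z := fun z => indicator_nonneg (fun _ _ => zero_le_one) z
  have hGe : ∀ z, G z = ((1 + |z|) ^ 2)⁻¹ := fun z => by
    simp only [G, Real.norm_eq_abs]
    rw [Real.rpow_neg (by positivity)]
    norm_cast
  rw [Real.norm_eq_abs, abs_of_nonneg (sq_nonneg _)]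
  simp only [Pi.add_apply, hGe, abs_sub_comm y x, ← add_mul, diffQuot]
  by_cases hxy : x ∈ Icc (-2 : ℝ) 2 ∨ y ∈ Icc (-2 : ℝ) 2
  · have hFS : 1 ≤ F y + F x := by
      rcases hxy with h | h
      · have : F x = 1 := by simp only [F, indicator_of_mem h]
        linarith [hF0 y]
      · have : F y = 1 := by simp only [F, indicator_of_mem h]
        linarith [hF0 x]
    have hq : ((plateau x - plateau y) / |x - y|) ^ 2 ≤ 2 ^ 2 * ((1 + |x - y|) ^ 2)⁻¹ := by
      rw [← div_eq_mul_inv, ← div_pow, ← sq_abs, abs_div, abs_abs]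
      apply pow_le_pow_left₀ (by positivity)
      rcases eq_or_ne x y with rfl | hne
      · simp
      · have hd : 0 < |x - y| := abs_pos.2 (sub_ne_zero.2 hne)
        have h1 := abs_plateau_sub_le x y
        have h2 : |plateau x - plateau y| ≤ 1 := by
          rw [abs_le]
          constructor <;> linarith [plateau_nonneg x, plateau_nonneg y, plateau_le_one x,
            plateau_le_one y]
        rw [div_le_div_iff₀ hd (by positivity)]
        nlinarith
    calc _ ≤ 2 ^ 2 * ((1 + |x - y|) ^ 2)⁻¹ := hq
      _ ≤ 2 ^ 2 * ((F y + F x) * ((1 + |x - y|) ^ 2)⁻¹) := by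
        apply mul_le_mul_of_nonneg_left _ (by positivity)
        exact le_mul_of_one_le_left (by positivity) hFS
  · have hout : ∀ z, z ∉ Icc (-2 : ℝ) 2 → plateau z = 0 := fun z hz => by
      refine plateau_eq_zero (le_of_not_ge fun h => hz ?_)
      exact abs_le.1 h
    push Not at hxy
    rw [hout x hxy.1, hout y hxy.2, sub_self, zero_div, zero_pow two_ne_zero]
    have := hF0 x
    have := hF0 y
    positivity

/-- A cutoff function with compact support in `(0, ∞)`. As a difference of two dilates of one
function, it has a Gagliardo seminorm bounded independently of `c`. -/
def cutoff (c t : ℝ) : ℝ := plateau (c⁻¹ * t) - plateau (c * t)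

theorem measurable_cutoff (c : ℝ) : Measurable (cutoff c) := by
  have := continuous_plateau.measurable
  unfold cutoff
  fun_prop

theorem abs_cutoff_le (c t : ℝ) : |cutoff c t| ≤ 1 := by
  rw [cutoff, abs_le]
  constructor <;> linarith [plateau_nonneg (c⁻¹ * t), plateau_nonneg (c * t),
    plateau_le_one (c⁻¹ * t), plateau_le_one (c * t)]

theorem cutoff_eq_zero {c t : ℝ} (hc : 1 ≤ c) (ht0 : 0 < t) (ht : t ∉ Icc c⁻¹ (2 * c)) :
    cutoff c t = 0 := by
  have hc0 : 0 < c := one_pos.trans_le hc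
  have hci : c⁻¹ ≤ 1 := inv_le_one_of_one_le₀ hc
  rcases lt_or_ge t c⁻¹ with h | h
  · have h1 : c * t ≤ 1 := by
      have := mul_le_mul_of_nonneg_left h.le hc0.le
      rwa [mul_inv_cancel₀ hc0.ne'] at this
    rw [cutoff, plateau_eq_one, plateau_eq_one, sub_self]
    · rwa [abs_of_pos (by positivity)]
    · rw [abs_of_pos (by positivity)]
      nlinarith [inv_pos.2 hc0]
  · have h2 : 2 * c < t := not_le.1 fun h' => ht ⟨h, h'⟩
    rw [cutoff, plateau_eq_zero, plateau_eq_zero, sub_self]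
    · rw [abs_of_pos (by positivity)]
      nlinarith
    · rw [abs_of_pos (by positivity), inv_mul_eq_div, le_div_iff₀ hc0]
      exact h2.le

theorem tendsto_cutoff {t : ℝ} (ht : 0 < t) :
    Tendsto (fun n : ℕ => cutoff (n + 1) t) atTop (𝓝 1) := by
  refine tendsto_const_nhds.congr' ?_
  filter_upwards [eventually_ge_atTop ⌈t⌉₊, eventually_ge_atTop ⌈2 / t⌉₊] with n h1 h2
  have h1' : t ≤ n := Nat.ceil_le.1 h1
  have h2' : 2 / t ≤ n := Nat.ceil_le.1 h2
  rw [div_le_iff₀ ht] at h2'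
  rw [cutoff, plateau_eq_one, plateau_eq_zero, sub_zero]
  · rw [abs_of_pos (by positivity)]
    nlinarith
  · rw [abs_of_pos (by positivity), inv_mul_eq_div, div_le_one (by positivity)]
    linarith

theorem eLpNorm_diffQuot_cutoff_le {c : ℝ} (hc : 0 < c) :
    eLpNorm (diffQuot (cutoff c)) 2 (vol.prod vol) ≤ 2 * eLpNorm (diffQuot plateau) 2 volume := by
  have hp := continuous_plateau.measurable
  have h1 : diffQuot (cutoff c) =
      diffQuot (fun t => plateau (c⁻¹ * t)) - diffQuot fun t => plateau (c * t) := by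
    funext p
    simp only [diffQuot, cutoff, Pi.sub_apply]
    ring
  have h2 : eLpNorm (diffQuot (cutoff c)) 2 (vol.prod vol) ≤
      eLpNorm (diffQuot (cutoff c)) 2 volume := by
    rw [Measure.prod_restrict, Measure.volume_eq_prod]
    exact eLpNorm_mono_measure _ Measure.restrict_le_self
  refine h2.trans ?_
  have hm : ∀ a : ℝ, Measurable fun t => plateau (a * t) := fun a =>
    hp.comp (measurable_const_mul a)
  rw [h1]
  refine (eLpNorm_sub_le (measurable_diffQuot (hm _)).aestronglyMeasurable
    (measurable_diffQuot (hm _)).aestronglyMeasurable (by norm_num)).trans ?_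
  rw [eLpNorm_diffQuot_comp_mul hp (inv_pos.2 hc), eLpNorm_diffQuot_comp_mul hp hc, two_mul]

/-- A bounded function is the limit of its products with the cutoff functions. Boundedness makes the
term `f(y) (χ(x) - χ(y)) / |x - y|` of the product rule controllable. -/
theorem approximable_of_bounded {W f : ℝ → ℝ} (hW : IsTameWeight W) (hf : Measurable f) {N : ℝ}
    (hN : ∀ x, |f x| ≤ N) (hfW : f ∈ weightedSpace W) : Approximable W f := by
  set u : ℕ → ℝ → ℝ := fun n => (Ioi (0 : ℝ)).indicator fun x => cutoff (n + 1) x * f x with hu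
  have hum : ∀ n, Measurable (u n) := fun n =>
    ((measurable_cutoff _).mul hf).indicator measurableSet_Ioi
  have hua : ∀ n, u n =ᵐ[vol] fun x => cutoff (n + 1) x * f x := fun n => by
    filter_upwards [ae_restrict_mem measurableSet_Ioi] with x hx
    simp only [hu, indicator_of_mem hx]
  have hle : ∀ n x, |u n x| ≤ |f x| := fun n x => by
    by_cases hx : x ∈ Ioi (0 : ℝ)
    · simp only [hu, indicator_of_mem hx, abs_mul]
      exact mul_le_of_le_one_left (abs_nonneg _) (abs_cutoff_le _ _)
    · simp [hu, indicator_of_notMem hx]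
  set D : ℝ≥0∞ := eLpNorm (diffQuot f) 2 (vol.prod vol) +
    ENNReal.ofReal N * (2 * eLpNorm (diffQuot plateau) 2 volume)
  have hD : D ≠ ∞ := ENNReal.add_ne_top.2 ⟨hfW.2.2.ne, ENNReal.mul_ne_top (by simp)
    (ENNReal.mul_ne_top (by simp) memLp_diffQuot_plateau.2.ne)⟩
  have hq : ∀ n, eLpNorm (diffQuot (u n)) 2 (vol.prod vol) ≤ D := by
    intro n
    rw [eLpNorm_congr_ae (diffQuot_congr (hua n))]
    -- the product rule for difference quotients
    have h1 : (diffQuot fun x => cutoff (n + 1) x * f x) =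
        (fun p => cutoff (n + 1) p.1 * diffQuot f p) +
          fun p => f p.2 * diffQuot (cutoff (n + 1)) p := by
      funext p
      simp only [diffQuot, Pi.add_apply]
      ring
    have hcm := measurable_cutoff ((n : ℝ) + 1)
    rw [h1]
    refine (eLpNorm_add_le
      ((hcm.comp measurable_fst).mul (measurable_diffQuot hf)).aestronglyMeasurable
      ((hf.comp measurable_snd).mul (measurable_diffQuot hcm)).aestronglyMeasurable
      (by norm_num)).trans (add_le_add ?_ ?_)
    · refine eLpNorm_mono fun p => ?_
      rw [Pi.mul_apply, norm_mul]
      exact mul_le_of_le_one_left (norm_nonneg _) (abs_cutoff_le _ _)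
    · refine (eLpNorm_le_mul_eLpNorm_of_ae_le_mul (c := N)
        (g := diffQuot (cutoff ((n : ℝ) + 1))) (Eventually.of_forall fun p => ?_) 2).trans ?_
      · rw [Pi.mul_apply, norm_mul]
        exact mul_le_mul_of_nonneg_right (hN _) (norm_nonneg _)
      · gcongr
        exact eLpNorm_diffQuot_cutoff_le (by positivity)
  set E : ℝ≥0∞ := eLpNorm (fun t => W t * f t) 2 vol
  refine Approximable.of_ae_tendsto (u := u) (C := max E D)
    (max_lt hfW.1.2 hD.lt_top).ne (fun n => ?_) (fun n => ?_)
    (fun n => (hq n).trans (le_max_right _ _)) hfW ?_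
  · refine approximable_of_compact_support hW (hum n) (a := ((n : ℝ) + 1)⁻¹) (b := 2 * (n + 1))
      (fun x => (hle n x).trans (hN x)) (by positivity) (fun x hx => ?_)
      ⟨(measurable_diffQuot (hum n)).aestronglyMeasurable, (hq n).trans_lt hD.lt_top⟩
    by_cases hx0 : x ∈ Ioi (0 : ℝ)
    · simp only [hu, indicator_of_mem hx0]
      rw [cutoff_eq_zero (by simp) hx0 hx, zero_mul]
    · simp only [hu, indicator_of_notMem hx0]
  · refine (eLpNorm_mono fun t => ?_).trans (le_max_left _ _)
    rw [norm_mul, norm_mul]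
    exact mul_le_mul_of_nonneg_left (hle n t) (norm_nonneg _)
  · filter_upwards [ae_restrict_mem measurableSet_Ioi] with x hx
    simp only [hu, indicator_of_mem hx]
    simpa using (tendsto_cutoff hx).mul_const (f x)

/-- Density of the test functions. It holds without any boundary condition, because the Gagliardo
seminorm of order `1/2` is critical. A general function is first truncated at height `n`. -/
theorem approximable_of_mem {W f : ℝ → ℝ} (hW : IsTameWeight W) (hf : Measurable f)
    (hfW : f ∈ weightedSpace W) : Approximable W f := by
  set u : ℕ → ℝ → ℝ := fun n x => max (min (f x) n) (-n) with hu
  have hum : ∀ n, Measurable (u n) := fun n => (hf.min measurable_const).max measurable_const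
  have hN : ∀ n x, |u n x| ≤ n := fun n x =>
    abs_le.2 ⟨le_max_right _ _, max_le (min_le_right _ _) (by
      have := n.cast_nonneg (α := ℝ)
      linarith)⟩
  have hlip : ∀ n x y, |u n x - u n y| ≤ |f x - f y| := fun n x y =>
    (abs_max_sub_max_le_abs _ _ _).trans <| by
      simpa using abs_min_sub_min_le_max (f x) (n : ℝ) (f y) n
  have hle : ∀ n x, |u n x| ≤ |f x| := fun n x => by
    have hn := n.cast_nonneg (α := ℝ)
    have h0 : max (min (0 : ℝ) n) (-n) = 0 := by
      rw [min_eq_left hn, max_eq_left (by linarith)]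
    have h1 := (abs_max_sub_max_le_abs (min (f x) (n : ℝ)) (min 0 n) (-n)).trans
      (abs_min_sub_min_le_max (f x) (n : ℝ) 0 n)
    rw [h0] at h1
    simpa using h1
  have h1 : ∀ n, eLpNorm (fun t => W t * u n t) 2 vol ≤ eLpNorm (fun t => W t * f t) 2 vol :=
    fun n => eLpNorm_mono fun t => by
      rw [norm_mul, norm_mul]
      exact mul_le_mul_of_nonneg_left (hle n t) (norm_nonneg _)
  have h2 : ∀ n, eLpNorm (diffQuot (u n)) 2 (vol.prod vol) ≤
      eLpNorm (diffQuot f) 2 (vol.prod vol) := fun n => eLpNorm_mono fun p => by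
    simp only [diffQuot, norm_div, Real.norm_eq_abs]
    exact div_le_div_of_nonneg_right (hlip n _ _) (abs_nonneg _)
  refine Approximable.of_ae_tendsto (u := u) (max_lt hfW.1.2 hfW.2.2).ne
    (fun n => approximable_of_bounded hW (hum n) (hN n) ⟨?_, ?_⟩)
    (fun n => (h1 n).trans (le_max_left _ _)) (fun n => (h2 n).trans (le_max_right _ _)) hfW ?_
  · exact ⟨(hW.measurable.mul (hum n)).aestronglyMeasurable, (h1 n).trans_lt hfW.1.2⟩
  · exact ⟨(measurable_diffQuot (hum n)).aestronglyMeasurable, (h2 n).trans_lt hfW.2.2⟩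
  · refine Eventually.of_forall fun x => tendsto_const_nhds.congr' ?_
    filter_upwards [eventually_ge_atTop ⌈|f x|⌉₊] with n hn
    have h := abs_le.1 (Nat.ceil_le.1 hn)
    simp only [hu]
    rw [min_eq_left h.2, max_eq_left h.1]

/-! ### The form on the line -/

theorem intervalIntegrable_div_sq {o : ℝ → ℝ} (ho : Continuous o) {a b : ℝ} (ha : 0 < a)
    (hb : 0 < b) : IntervalIntegrable (fun z => o z / z ^ 2) volume a b := by
  refine ContinuousOn.intervalIntegrable fun z hz => ?_
  have hz0 : 0 < z := (lt_min ha hb).trans_le hz.1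
  exact (ho.continuousAt.div (by fun_prop) (by positivity)).continuousWithinAt

/-- A Frullani integral: `(o(2h) - 2 o(h)) / (2 h²)` is the derivative of `∫_h^{2h} o(z) / z² dz`,
which tends to `o'(0) log 2` at the origin and to `0` at infinity. -/
theorem integral_frullani {o : ℝ → ℝ} (ho : Continuous o) (h0 : o 0 = 0) {M d : ℝ}
    (hM : ∀ x, |o x| ≤ M) (hd : HasDerivAt o d 0)
    (hint : IntegrableOn (fun h => (2 * o h - o (2 * h)) / h ^ 2) (Ioi 0)) :
    ∫ h in Ioi 0, (2 * o h - o (2 * h)) / h ^ 2 = 2 * Real.log 2 * d := by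
  set P : ℝ → ℝ := fun h => ∫ z in (1 : ℝ)..h, o z / z ^ 2 with hP
  -- the value at the origin is the limit, which makes the antiderivative continuous there
  set Q : ℝ → ℝ := fun h => if h ≤ 0 then d * Real.log 2 else P (2 * h) - P h with hQ
  have hPd : ∀ x > 0, HasDerivAt P (o x / x ^ 2) x := fun x hx =>
    intervalIntegral.integral_hasDerivAt_right (intervalIntegrable_div_sq ho one_pos hx)
      (Measurable.stronglyMeasurable (by
        have := ho.measurable
        fun_prop)).stronglyMeasurableAtFilter
      (ho.continuousAt.div (by fun_prop) (by positivity))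
  have hQd : ∀ x ∈ Ioi (0 : ℝ), HasDerivAt Q (-(1 / 2) * ((2 * o x - o (2 * x)) / x ^ 2)) x := by
    intro x hx
    have hx0 : 0 < x := hx
    have h1 : HasDerivAt (fun h => P (2 * h)) (o (2 * x) / (2 * x) ^ 2 * 2) x :=
      (hPd (2 * x) (by positivity)).comp x (by simpa using (hasDerivAt_id x).const_mul 2)
    have h2 := (h1.sub (hPd x hx0)).congr_of_eventuallyEq (f₁ := Q) (by
      filter_upwards [Ioi_mem_nhds hx0] with y hy
      simp only [hQ, if_neg (not_le.2 (mem_Ioi.1 hy))]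
      rfl)
    refine h2.congr_deriv ?_
    field_simp
    ring
  have hQi : ∀ h > 0, Q h = ∫ z in h..(2 * h), o z / z ^ 2 := fun h hh => by
    simp only [hQ, if_neg (not_le.2 hh), hP]
    exact intervalIntegral.integral_interval_sub_left
      (intervalIntegrable_div_sq ho one_pos (by positivity))
      (intervalIntegrable_div_sq ho one_pos hh)
  have hQinf : Tendsto Q atTop (𝓝 0) := by
    have h1 : Tendsto (fun h : ℝ => M * h⁻¹) atTop (𝓝 0) := by
      simpa using tendsto_inv_atTop_zero.const_mul M
    refine squeeze_zero_norm' ?_ h1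
    filter_upwards [eventually_gt_atTop 0] with h hh
    rw [hQi h hh]
    refine (intervalIntegral.norm_integral_le_of_norm_le_const (C := M / h ^ 2)
      fun z hz => ?_).trans (le_of_eq ?_)
    · rw [uIoc_of_le (by linarith)] at hz
      rw [norm_div, Real.norm_eq_abs, Real.norm_of_nonneg (sq_nonneg z)]
      have hM0 := (abs_nonneg _).trans (hM 0)
      gcongr
      · exact hM z
      · exact hz.1.le
    · rw [abs_of_pos (by linarith)]
      field_simp
      ring
  have hQ0 : ContinuousWithinAt Q (Ici 0) 0 := by
    have hQ00 : Q 0 = d * Real.log 2 := by simp [hQ]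
    rw [Metric.continuousWithinAt_iff]
    intro ε hε
    have hlo := hd.isLittleO
    rw [Asymptotics.isLittleO_iff] at hlo
    obtain ⟨δ, hδ, hδo⟩ := Metric.eventually_nhds_iff.1 (hlo (half_pos hε))
    refine ⟨δ / 2, by positivity, fun h hh hhδ => ?_⟩
    rw [hQ00]
    rcases eq_or_lt_of_le (mem_Ici.1 hh) with rfl | hpos
    · rw [hQ00, dist_self]
      exact hε
    · rw [Real.dist_eq, sub_zero, abs_of_pos hpos] at hhδ
      have hlog : d * Real.log 2 = ∫ z in h..(2 * h), d * z⁻¹ := by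
        rw [intervalIntegral.integral_const_mul, integral_inv_of_pos hpos (by positivity),
          mul_div_cancel_right₀ _ hpos.ne']
      have hint2 : IntervalIntegrable (fun z => d * z⁻¹) volume h (2 * h) := by
        refine ContinuousOn.intervalIntegrable fun z hz => ?_
        have hz0 : 0 < z := (lt_min hpos (by positivity)).trans_le hz.1
        exact (continuousAt_const.mul (continuousAt_inv₀ hz0.ne')).continuousWithinAt
      rw [hQi h hpos, hlog, Real.dist_eq, ← intervalIntegral.integral_sub
        (intervalIntegrable_div_sq ho hpos (by positivity)) hint2, ← Real.norm_eq_abs]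
      refine (intervalIntegral.norm_integral_le_of_norm_le_const (C := ε / 2 / h)
        fun z hz => ?_).trans_lt ?_
      · rw [uIoc_of_le (by linarith)] at hz
        have hz0 : 0 < z := hpos.trans hz.1
        have h3 := hδo (y := z) (by
          rw [Real.dist_eq, sub_zero, abs_of_pos hz0]
          linarith [hz.2])
        simp only [h0, sub_zero, smul_eq_mul, Real.norm_eq_abs, abs_of_pos hz0] at h3
        have h4 : o z / z ^ 2 - d * z⁻¹ = (o z - z * d) / z ^ 2 := by
          field_simp
        rw [h4, norm_div, Real.norm_eq_abs, Real.norm_of_nonneg (sq_nonneg z)]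
        calc |o z - z * d| / z ^ 2 ≤ ε / 2 * z / z ^ 2 := by gcongr
          _ = ε / 2 / z := by field_simp
          _ ≤ ε / 2 / h := by
            gcongr
            exact hz.1.le
      · rw [abs_of_pos (by linarith)]
        have : ε / 2 / h * (2 * h - h) = ε / 2 := by
          field_simp
          ring
        linarith
  have key := integral_Ioi_of_hasDerivAt_of_tendsto hQ0 hQd (hint.const_mul _) hQinf
  rw [integral_const_mul] at key
  have hQ00 : Q 0 = d * Real.log 2 := by simp [hQ]
  rw [hQ00] at key
  linarith

/-- The correlation `t ↦ ∫ α(x) β(x + t) dx`. -/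
def correlation (α β : ℝ → ℝ) (t : ℝ) : ℝ := ∫ x, α x * β (x + t)

section Correlation

variable {α β : ℝ → ℝ}

theorem integrable_mul_shift (hα : Continuous α) (hαc : HasCompactSupport α) (hβ : Continuous β)
    (s t : ℝ) : Integrable fun x => α (x + s) * β (x + t) := by
  refine Continuous.integrable_of_hasCompactSupport (by fun_prop) ?_
  exact (hαc.comp_homeomorph (Homeomorph.addRight s)).mul_right

theorem integral_mul_shift (s t : ℝ) :
    ∫ x, α (x + s) * β (x + t) = correlation α β (t - s) := by
  rw [correlation, ← integral_add_right_eq_self (fun x => α x * β (x + (t - s))) s]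
  simp only [add_assoc, add_sub_cancel]

theorem hasDerivAt_correlation (hα : Continuous α) (hαc : HasCompactSupport α)
    (hβ : ContDiff ℝ 1 β) (hβc : HasCompactSupport β) (t : ℝ) :
    HasDerivAt (correlation α β) (∫ x, α x * deriv β (x + t)) t := by
  have hβ' : Continuous (deriv β) := hβ.continuous_deriv le_rfl
  obtain ⟨K, hK⟩ := hβ'.bounded_above_of_compact_support hβc.deriv
  have hβ0 := hβ.continuous
  refine (hasDerivAt_integral_of_dominated_loc_of_deriv_le (s := univ)
    (F := fun t x => α x * β (x + t)) (F' := fun t x => α x * deriv β (x + t))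
    (bound := fun x => ‖α x‖ * K) univ_mem
    (Eventually.of_forall fun s => Continuous.aestronglyMeasurable (by fun_prop)) ?_
    (Continuous.aestronglyMeasurable (by fun_prop)) ?_ ?_ ?_).2
  · simpa using integrable_mul_shift hα hαc hβ0 0 t
  · refine Eventually.of_forall fun x s _ => ?_
    rw [norm_mul]
    gcongr
    exact hK _
  · exact (hα.integrable_of_hasCompactSupport (μ := volume) hαc).norm.mul_const K
  · refine Eventually.of_forall fun x s _ => HasDerivAt.const_mul (α x) ?_
    have h1 : HasDerivAt β (deriv β (x + s)) (x + s) :=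
      (hβ.differentiable one_ne_zero _).hasDerivAt
    exact h1.comp_const_add x s

theorem abs_correlation_le (hα : Continuous α) (hαc : HasCompactSupport α) {K : ℝ}
    (hK : ∀ x, |β x| ≤ K) (t : ℝ) : |correlation α β t| ≤ ∫ x, ‖α x‖ * K := by
  rw [← Real.norm_eq_abs, correlation]
  refine norm_integral_le_of_norm_le
    ((hα.integrable_of_hasCompactSupport (μ := volume) hαc).norm.mul_const K)
    (Eventually.of_forall fun x => ?_)
  rw [norm_mul]
  gcongr
  exact hK _

end Correlation

/-- The difference quotient with the sign of `y - x` included. -/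
def signedQuot (f : ℝ → ℝ) (p : ℝ × ℝ) : ℝ := (f p.1 - f p.2) / (p.2 - p.1)

theorem norm_signedQuot (f : ℝ → ℝ) (p : ℝ × ℝ) : ‖signedQuot f p‖ = ‖diffQuot f p‖ := by
  simp only [signedQuot, diffQuot, norm_div, Real.norm_eq_abs, abs_abs, abs_sub_comm p.2 p.1]

theorem measurable_signedQuot {f : ℝ → ℝ} (hf : Measurable f) : Measurable (signedQuot f) := by
  unfold signedQuot
  fun_prop

/-- The map `(x, y) ↦ (y, 2 y - x)`: a pair of points is moved forward by its own difference. -/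
def stepMap (p : ℝ × ℝ) : ℝ × ℝ := (p.2, 2 * p.2 - p.1)

theorem measurePreserving_stepMap : MeasurePreserving stepMap volume volume := by
  have h := (measurePreserving_prod_add (volume : Measure ℝ) volume).comp
    ((measurePreserving_add_prod (volume : Measure ℝ) volume).comp
      (measurePreserving_prod_neg_add (volume : Measure ℝ) volume))
  have heq : stepMap = (fun z : ℝ × ℝ => (z.1, z.1 + z.2)) ∘
      (fun z : ℝ × ℝ => (z.1 + z.2, z.2)) ∘ fun z : ℝ × ℝ => (z.1, -z.1 + z.2) := by
    funext p
    simp only [stepMap, Function.comp_apply, Prod.mk.injEq]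
    constructor <;> ring
  rw [heq]
  exact h

/-- The bilinear form
`∬ (f(x) - f(y)) (g(y) - g(2y - x)) / ((y - x) |y - x|) dx dy` on the line. -/
def lineForm (f g : ℝ → ℝ) : ℝ := ∫ p, signedQuot f p * diffQuot g (stepMap p)

theorem memLp_signedQuot {f : ℝ → ℝ} (hf : Measurable f) (h : MemLp (diffQuot f) 2 volume) :
    MemLp (signedQuot f) 2 volume :=
  h.of_le (measurable_signedQuot hf).aestronglyMeasurable
    (Eventually.of_forall fun p => (norm_signedQuot f p).le)

theorem memLp_diffQuot_stepMap {g : ℝ → ℝ} (h : MemLp (diffQuot g) 2 volume) :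
    MemLp (fun p => diffQuot g (stepMap p)) 2 volume :=
  h.comp_measurePreserving measurePreserving_stepMap

theorem abs_lineForm_le {f g : ℝ → ℝ} (hf : Measurable f) (hfq : MemLp (diffQuot f) 2 volume)
    (hgq : MemLp (diffQuot g) 2 volume) :
    |lineForm f g| ≤ (eLpNorm (diffQuot f) 2 volume).toReal *
      (eLpNorm (diffQuot g) 2 volume).toReal := by
  have e1 : eLpNorm (signedQuot f) 2 volume = eLpNorm (diffQuot f) 2 volume :=
    eLpNorm_congr_norm_ae (Eventually.of_forall (norm_signedQuot f))
  have e2 : eLpNorm (diffQuot g ∘ stepMap) 2 volume = eLpNorm (diffQuot g) 2 volume :=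
    eLpNorm_comp_measurePreserving hgq.1 measurePreserving_stepMap
  rw [← e1, ← e2]
  exact abs_integral_mul_le (memLp_signedQuot hf hfq) (memLp_diffQuot_stepMap hgq)

/-- On smooth functions the form is a multiple of `∫ α β'`. In the variables `(x, h) = (x, y - x)` the
inner integral consists of values of the correlation, which leaves a Frullani integral in `h`. -/
theorem lineForm_eq {α β : ℝ → ℝ} (hα : Continuous α) (hαc : HasCompactSupport α)
    (hαq : MemLp (diffQuot α) 2 volume) (hβ : ContDiff ℝ 1 β) (hβc : HasCompactSupport β)
    (hβq : MemLp (diffQuot β) 2 volume) :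
    lineForm α β = 4 * Real.log 2 * ∫ x, α x * deriv β x := by
  have hβ0 := hβ.continuous
  set c := correlation α β with hc
  have hcd := hasDerivAt_correlation hα hαc hβ hβc
  have hcc : Continuous c := continuous_iff_continuousAt.2 fun t => (hcd t).continuousAt
  obtain ⟨K, hK⟩ := hβ0.bounded_above_of_compact_support hβc
  set k : ℝ → ℝ := fun h => 2 * c h - c (2 * h) - c 0 with hk
  have hint : Integrable (fun p => signedQuot α p * diffQuot β (stepMap p)) :=
    integrable_mul_of_memLp (memLp_signedQuot hα.measurable hαq) (memLp_diffQuot_stepMap hβq)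
  have hshear : MeasurePreserving (MeasurableEquiv.shearAddRight ℝ)
      (volume.prod volume) (volume.prod volume) := measurePreserving_prod_add volume volume
  have hint2 : Integrable (fun p : ℝ × ℝ => signedQuot α (p.1, p.1 + p.2) *
      diffQuot β (stepMap (p.1, p.1 + p.2))) (volume.prod volume) :=
    hshear.integrable_comp_of_integrable
      (g := fun p : ℝ × ℝ => signedQuot α p * diffQuot β (stepMap p)) hint
  have hinner : ∀ h, ∫ x, signedQuot α (x, x + h) * diffQuot β (stepMap (x, x + h)) =
      k h / (h * |h|) := by
    intro h
    have h1 : ∀ x, signedQuot α (x, x + h) * diffQuot β (stepMap (x, x + h)) =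
        (α (x + 0) * β (x + h) - α (x + 0) * β (x + 2 * h) - α (x + h) * β (x + h) +
          α (x + h) * β (x + 2 * h)) / (h * |h|) := by
      intro x
      have e1 : 2 * (x + h) - x = x + 2 * h := by ring
      have e2 : x + h - (x + 2 * h) = -h := by ring
      simp only [signedQuot, diffQuot, stepMap, e1, e2, abs_neg, add_sub_cancel_left, add_zero]
      rw [div_mul_div_comm]
      congr 1
      ring
    have hi := integrable_mul_shift hα hαc hβ0
    have hi1 : Integrable fun x => α (x + 0) * β (x + h) - α (x + 0) * β (x + 2 * h) :=
      (hi 0 h).sub (hi 0 (2 * h))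
    have hi2 : Integrable fun x =>
        α (x + 0) * β (x + h) - α (x + 0) * β (x + 2 * h) - α (x + h) * β (x + h) :=
      hi1.sub (hi h h)
    simp only [h1]
    rw [integral_div, integral_add hi2 (hi h (2 * h)), integral_sub hi1 (hi h h),
      integral_sub (hi 0 h) (hi 0 (2 * h))]
    simp only [integral_mul_shift, ← hc, hk]
    rw [sub_self, sub_zero, sub_zero, show 2 * h - h = h by ring]
    ring
  have hkint : Integrable fun h => k h / (h * |h|) := by
    have := hint2.integral_prod_right
    simpa only [hinner] using this
  have hform : lineForm α β = ∫ h, k h / (h * |h|) := by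
    have e1 := hshear.integral_comp' (g := fun p => signedQuot α p * diffQuot β (stepMap p))
    rw [lineForm, Measure.volume_eq_prod, ← e1]
    refine (integral_prod_symm _ hint2).trans ?_
    simp only [hinner]
  -- the kernel `1 / (h |h|)` is odd, so only the odd part of the correlation contributes
  set o : ℝ → ℝ := fun h => c h - c (-h) with ho
  have hneg : IntegrableOn (fun h => k (-h) / (-h * |-h|)) (Ioi 0) :=
    (hkint.comp_neg).integrableOn
  have hsplit : ∫ h, k h / (h * |h|) = ∫ h in Ioi 0, (2 * o h - o (2 * h)) / h ^ 2 := by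
    rw [← integral_add_compl (measurableSet_Ioi (a := (0 : ℝ))) hkint, compl_Ioi]
    have e2 := integral_comp_neg_Iic 0 fun h => k (-h) / (-h * |-h|)
    simp only [neg_neg, neg_zero] at e2
    rw [e2, ← integral_add hkint.integrableOn hneg]
    refine setIntegral_congr_fun measurableSet_Ioi fun h hh => ?_
    have hh0 : 0 < h := hh
    simp only [abs_neg, abs_of_pos hh0, hk, ho]
    rw [neg_mul, div_neg, ← sub_eq_add_neg, ← sub_div, ← sq]
    congr 1
    rw [show 2 * -h = -(2 * h) by ring]
    ring
  have hoint : IntegrableOn (fun h => (2 * o h - o (2 * h)) / h ^ 2) (Ioi 0) := by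
    refine (hkint.integrableOn.add hneg).congr_fun (fun h hh => ?_) measurableSet_Ioi
    have hh0 : 0 < h := hh
    simp only [Pi.add_apply, abs_neg, abs_of_pos hh0, hk, ho]
    rw [neg_mul, div_neg, ← sub_eq_add_neg, ← sub_div, ← sq]
    congr 1
    rw [show 2 * -h = -(2 * h) by ring]
    ring
  have hod : HasDerivAt o (2 * ∫ x, α x * deriv β x) 0 := by
    have h1 := hcd 0
    simp only [add_zero] at h1
    have h2 : HasDerivAt (fun h => c (-h)) (-∫ x, α x * deriv β x) 0 := by
      have h3 := HasDerivAt.scomp (h := fun h : ℝ => -h) (h' := -1) (0 : ℝ)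
        (g₁ := c) (g₁' := ∫ x, α x * deriv β x) (by simpa using h1) (hasDerivAt_neg 0)
      rw [neg_one_smul] at h3
      exact h3
    refine (h1.sub h2).congr_deriv ?_
    ring
  have hob : ∀ x, |o x| ≤ 2 * ∫ x, ‖α x‖ * K := fun x => by
    have h1 := abs_correlation_le hα hαc hK x
    have h2 := abs_correlation_le hα hαc hK (-x)
    have h3 := abs_sub (c x) (c (-x))
    simp only [ho, hc] at h3 ⊢
    linarith
  rw [hform, hsplit, integral_frullani (by fun_prop) (by simp [ho]) hob hod hoint]
  ring

/-! ### Norms and the graph space -/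

theorem tstar_pos {t : ℝ} (ht : 0 < t) : 0 < tstar t := by
  unfold tstar
  split_ifs
  · exact ht
  · exact one_pos

theorem tstar_le {t : ℝ} : tstar t ≤ t := by
  unfold tstar
  split_ifs with h
  · exact le_rfl
  · exact (not_le.1 h).le

theorem measurable_tstar : Measurable tstar :=
  Measurable.ite measurableSet_Iic measurable_id measurable_const

theorem weighted_sq {f : ℝ → ℝ} {t : ℝ} (ht : 0 < t) :
    weighted f t ^ 2 = (tstar t)⁻¹ * f t ^ 2 := by
  have h : (tstar t ^ (-(1 / 2) : ℝ)) ^ 2 = (tstar t)⁻¹ := by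
    rw [← Real.rpow_natCast, ← Real.rpow_mul (tstar_pos ht).le, ← Real.rpow_neg_one]
    norm_num
  rw [weighted, mul_pow, h]

theorem ae_weighted_sq (f : ℝ → ℝ) :
    (fun t => weighted f t ^ 2) =ᵐ[vol] fun t => (tstar t)⁻¹ * f t ^ 2 := by
  filter_upwards [ae_restrict_mem measurableSet_Ioi] with t ht using weighted_sq ht

/-- The weight `(1 + 1 / t*)^{1/2}`, which turns the norm of `H^{1/2}_{00}` into a graph norm. -/
def hardyWeight (t : ℝ) : ℝ := Real.sqrt (1 + (tstar t)⁻¹)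

theorem hardyWeight_mul_sq {f : ℝ → ℝ} {t : ℝ} (ht : 0 < t) :
    (hardyWeight t * f t) ^ 2 = f t ^ 2 + (tstar t)⁻¹ * f t ^ 2 := by
  have := inv_pos.2 (tstar_pos ht)
  rw [hardyWeight, mul_pow, Real.sq_sqrt (by positivity)]
  ring

theorem isTameWeight_hardyWeight : IsTameWeight hardyWeight where
  measurable := (measurable_const.add measurable_tstar.inv).sqrt
  bounded a ha := by
    refine ⟨Real.sqrt (1 + (min a 1)⁻¹), fun t ht => ?_⟩
    rw [hardyWeight, abs_of_nonneg (Real.sqrt_nonneg _)]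
    have h0 : 0 < min a 1 := lt_min ha one_pos
    gcongr
    unfold tstar
    split_ifs
    · exact (min_le_left _ _).trans ht
    · exact min_le_right _ _

theorem isTameWeight_one : IsTameWeight fun _ => 1 where
  measurable := measurable_const
  bounded _ _ := ⟨1, fun _ _ => by simp⟩

theorem HHalf.mem_weightedSpace {f : L2} (hf : f ∈ HHalf) :
    (f : ℝ → ℝ) ∈ weightedSpace fun _ => 1 :=
  ⟨by simpa using Lp.memLp f, hf⟩

theorem HHalf00.mem_weightedSpace {f : L2} (hf : f ∈ HHalf00) :
    (f : ℝ → ℝ) ∈ weightedSpace hardyWeight := by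
  refine ⟨?_, hf.1⟩
  refine MemLp.of_le ((Lp.memLp f).norm.add hf.2.norm)
    (isTameWeight_hardyWeight.measurable.aestronglyMeasurable.mul (Lp.memLp f).1) ?_
  filter_upwards [ae_restrict_mem measurableSet_Ioi] with t ht
  simp only [Pi.add_apply, Real.norm_eq_abs]
  rw [abs_of_nonneg (by positivity : 0 ≤ |f t| + |weighted f t|)]
  refine abs_le_of_sq_le_sq ?_ (by positivity)
  rw [hardyWeight_mul_sq ht, ← weighted_sq ht, add_sq, sq_abs, sq_abs]
  have : 0 ≤ 2 * |f t| * |weighted f t| := by positivity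
  linarith

theorem integrable_tstar_inv_mul_sq {f : L2} (hf : f ∈ HHalf00) :
    Integrable (fun t => (tstar t)⁻¹ * f t ^ 2) vol :=
  hf.2.integrable_sq.congr (ae_weighted_sq f)

theorem normHHalf_sq (f : L2) :
    normHHalf f ^ 2 = (∫ t, f t ^ 2 ∂vol) + ∫ p, diffQuot f p ^ 2 ∂(vol.prod vol) :=
  Real.sq_sqrt (add_nonneg (integral_nonneg fun _ => sq_nonneg _)
    (integral_nonneg fun _ => sq_nonneg _))

theorem integral_tstar_nonneg (f : L2) : 0 ≤ ∫ t, (tstar t)⁻¹ * f t ^ 2 ∂vol := by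
  rw [← integral_congr_ae (ae_weighted_sq f)]
  exact integral_nonneg fun _ => sq_nonneg _

theorem normHHalf00_sq (f : L2) :
    normHHalf00 f ^ 2 = normHHalf f ^ 2 + ∫ t, (tstar t)⁻¹ * f t ^ 2 ∂vol :=
  Real.sq_sqrt (add_nonneg (sq_nonneg _) (integral_tstar_nonneg f))

theorem normHHalf_nonneg (f : L2) : 0 ≤ normHHalf f := Real.sqrt_nonneg _

theorem normHHalf00_nonneg (f : L2) : 0 ≤ normHHalf00 f := Real.sqrt_nonneg _

theorem norm_le_normHHalf (f : L2) : ‖f‖ ≤ normHHalf f := by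
  refine le_of_sq_le_sq ?_ (normHHalf_nonneg f)
  rw [normHHalf_sq, Lp.norm_def, eLpNorm_two_toReal_sq (Lp.memLp f)]
  exact le_add_of_nonneg_right (integral_nonneg fun _ => sq_nonneg _)

theorem normHHalf_le_normHHalf00 (f : L2) : normHHalf f ≤ normHHalf00 f := by
  refine le_of_sq_le_sq ?_ (normHHalf00_nonneg f)
  rw [normHHalf00_sq]
  exact le_add_of_nonneg_right (integral_tstar_nonneg f)

theorem graphMap_congr {W f g : ℝ → ℝ} (hfg : f =ᵐ[vol] g) (hf : f ∈ weightedSpace W)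
    (hg : g ∈ weightedSpace W) : graphMap W ⟨f, hf⟩ = graphMap W ⟨g, hg⟩ := by
  simp only [graphMap, LinearMap.coe_mk, AddHom.coe_mk]
  congr 2
  · refine MemLp.toLp_congr _ _ ?_
    filter_upwards [hfg] with t ht
    rw [ht]
  · exact MemLp.toLp_congr _ _ (diffQuot_congr hfg)

/-- The graph map on a space of classes of functions. -/
def graphEmbedding (W : ℝ → ℝ) (S : Submodule ℝ L2)
    (hS : ∀ f ∈ S, (f : ℝ → ℝ) ∈ weightedSpace W) : S →ₗ[ℝ] GraphSpace where
  toFun f := graphMap W ⟨f, hS f f.2⟩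
  map_add' f g := by
    rw [← map_add]
    exact graphMap_congr (Lp.coeFn_add _ _) _ _
  map_smul' c f := by
    rw [RingHom.id_apply, ← map_smul]
    exact graphMap_congr (Lp.coeFn_smul _ _) _ _

/-- A functional that is bounded in the graph norm and vanishes on test functions is zero. -/
theorem eq_zero_of_vanish_on_tests {W : ℝ → ℝ} (hW : IsTameWeight W) {S : Submodule ℝ L2}
    (hS : ∀ f ∈ S, (f : ℝ → ℝ) ∈ weightedSpace W) (htest : ∀ φ, testL2 φ ∈ S)
    (ℓ : S →ₗ[ℝ] ℝ) {C : ℝ} (hC : ∀ f, |ℓ f| ≤ C * ‖graphEmbedding W S hS f‖)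
    (h0 : ∀ φ, ℓ ⟨testL2 φ, htest φ⟩ = 0) : ℓ = 0 := by
  set J := graphEmbedding W S hS
  ext f
  have hcl : J f ∈ testClosure W :=
    (approximable_of_mem hW (Lp.stronglyMeasurable (f : L2)).measurable (hS f f.2)).2
  have hle : testClosure W ≤ (Submodule.map J (LinearMap.ker ℓ)).topologicalClosure := by
    refine Submodule.topologicalClosure_mono (Submodule.span_le.2 ?_)
    rintro _ ⟨⟨u, hu⟩, ⟨φ, hφ⟩, rfl⟩
    refine ⟨⟨testL2 φ, htest φ⟩, h0 φ, ?_⟩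
    refine graphMap_congr ?_ _ _
    rw [← (show (φ : ℝ → ℝ) = u from hφ)]
    exact testL2_ae φ
  have hcl2 : J f ∈ closure (Submodule.map J (LinearMap.ker ℓ) : Set GraphSpace) := hle hcl
  have hsmall : ∀ ε > 0, |ℓ f| ≤ |C| * ε := by
    intro ε hε
    obtain ⟨_, ⟨k, hk, rfl⟩, hkε⟩ := Metric.mem_closure_iff.1 hcl2 ε hε
    have h1 : ℓ f = ℓ (f - k) := by
      rw [map_sub, LinearMap.mem_ker.1 hk, sub_zero]
    rw [h1]
    refine (hC _).trans ?_
    rw [map_sub, ← dist_eq_norm]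
    exact mul_le_mul (le_abs_self C) hkε.le dist_nonneg (abs_nonneg C)
  have h2 : |ℓ f| ≤ 0 := by
    refine le_of_forall_pos_le_add fun ε hε => ?_
    refine (hsmall (ε / (|C| + 1)) (by positivity)).trans ?_
    rw [zero_add, mul_div_assoc', div_le_iff₀ (by positivity)]
    nlinarith [abs_nonneg C]
  simpa using h2

theorem norm_graphEmbedding_HHalf (f : HHalf) :
    ‖graphEmbedding (fun _ => 1) HHalf (fun _ h => HHalf.mem_weightedSpace h) f‖ =
      normHHalf f := by
  rw [← sq_eq_sq₀ (norm_nonneg _) (normHHalf_nonneg _), normHHalf_sq]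
  refine (norm_graphMap_sq _ _).trans ?_
  simp only [one_mul]

theorem norm_graphEmbedding_HHalf00 (f : HHalf00) :
    ‖graphEmbedding hardyWeight HHalf00 (fun _ h => HHalf00.mem_weightedSpace h) f‖ =
      normHHalf00 f := by
  rw [← sq_eq_sq₀ (norm_nonneg _) (normHHalf00_nonneg _), normHHalf00_sq, normHHalf_sq]
  refine (norm_graphMap_sq _ _).trans ?_
  have h1 : ∫ t, (hardyWeight t * (f : L2) t) ^ 2 ∂vol =
      ∫ t, ((f : L2) t ^ 2 + (tstar t)⁻¹ * (f : L2) t ^ 2) ∂vol := by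
    refine integral_congr_ae ?_
    filter_upwards [ae_restrict_mem measurableSet_Ioi] with t ht using hardyWeight_mul_sq ht
  simp only [h1]
  rw [integral_add (Lp.memLp (f : L2)).integrable_sq (integrable_tstar_inv_mul_sq f.2)]
  ring

/-- Bounded functionals on `H^{1/2}` are determined by their values on test functions. -/
theorem HHalf.functional_ext {ℓ₁ ℓ₂ : HHalf →ₗ[ℝ] ℝ} (h₁ : ∃ C, ∀ g, |ℓ₁ g| ≤ C * normHHalf g)
    (h₂ : ∃ C, ∀ g, |ℓ₂ g| ≤ C * normHHalf g)
    (h : ∀ ψ, ℓ₁ (testHHalf ψ) = ℓ₂ (testHHalf ψ)) : ℓ₁ = ℓ₂ := by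
  obtain ⟨C₁, h₁⟩ := h₁
  obtain ⟨C₂, h₂⟩ := h₂
  refine sub_eq_zero.1 (eq_zero_of_vanish_on_tests isTameWeight_one
    (fun _ h => HHalf.mem_weightedSpace h) testL2_mem_HHalf (ℓ₁ - ℓ₂) (C := C₁ + C₂)
    (fun g => ?_) fun ψ => sub_eq_zero.2 (h ψ))
  rw [norm_graphEmbedding_HHalf, LinearMap.sub_apply, add_mul]
  exact (abs_sub _ _).trans (add_le_add (h₁ g) (h₂ g))

/-- Bounded functionals on `H^{1/2}_{00}` are determined by their values on test functions. -/
theorem HHalf00.functional_ext {ℓ₁ ℓ₂ : HHalf00 →ₗ[ℝ] ℝ}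
    (h₁ : ∃ C, ∀ f, |ℓ₁ f| ≤ C * normHHalf00 f) (h₂ : ∃ C, ∀ f, |ℓ₂ f| ≤ C * normHHalf00 f)
    (h : ∀ φ, ℓ₁ (testHHalf00 φ) = ℓ₂ (testHHalf00 φ)) : ℓ₁ = ℓ₂ := by
  obtain ⟨C₁, h₁⟩ := h₁
  obtain ⟨C₂, h₂⟩ := h₂
  refine sub_eq_zero.1 (eq_zero_of_vanish_on_tests isTameWeight_hardyWeight
    (fun _ h => HHalf00.mem_weightedSpace h) testL2_mem_HHalf00 (ℓ₁ - ℓ₂) (C := C₁ + C₂)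
    (fun g => ?_) fun ψ => sub_eq_zero.2 (h ψ))
  rw [norm_graphEmbedding_HHalf00, LinearMap.sub_apply, add_mul]
  exact (abs_sub _ _).trans (add_le_add (h₁ g) (h₂ g))

/-! ### The form on the half-line -/

/-- Extension by zero from `(0, ∞)` to the line. -/
def zeroExtension (f : ℝ → ℝ) : ℝ → ℝ := (Ioi (0 : ℝ)).indicator f

/-- Even reflection from `(0, ∞)` to the line. -/
def evenExtension (g : ℝ → ℝ) (x : ℝ) : ℝ := g |x|

theorem zeroExtension_ae {f : ℝ → ℝ} : zeroExtension f =ᵐ[vol] f :=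
  indicator_ae_eq_restrict measurableSet_Ioi

theorem zeroExtension_congr {f g : ℝ → ℝ} (h : f =ᵐ[vol] g) :
    zeroExtension f =ᵐ[volume] zeroExtension g :=
  (ae_eq_restrict_iff_indicator_ae_eq measurableSet_Ioi).1 h

theorem quasiMeasurePreserving_abs :
    Measure.QuasiMeasurePreserving (fun x : ℝ => |x|) volume vol := by
  have hm : Measurable fun x : ℝ => |x| := measurable_id.abs
  refine ⟨hm, Measure.AbsolutelyContinuous.mk fun s hs h0 => ?_⟩
  rw [Measure.map_apply hm hs, ← lintegral_indicator_one (hm hs)]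
  refine (lintegral_comp_abs (F := s.indicator 1) (measurable_one.indicator hs)).trans ?_
  rw [lintegral_indicator_one hs, h0, mul_zero]

theorem evenExtension_congr {f g : ℝ → ℝ} (h : f =ᵐ[vol] g) :
    evenExtension f =ᵐ[volume] evenExtension g :=
  quasiMeasurePreserving_abs.ae_eq_comp h

theorem lineForm_congr {f f' g g' : ℝ → ℝ} (hf : f =ᵐ[volume] f') (hg : g =ᵐ[volume] g') :
    lineForm f g = lineForm f' g' := by
  refine integral_congr_ae ?_
  filter_upwards [ae_fst_snd hf, measurePreserving_stepMap.quasiMeasurePreserving.ae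
    (ae_fst_snd hg)] with p hp hq
  simp only [signedQuot, diffQuot, hp.1, hp.2, hq.1, hq.2]

theorem diffQuot_zeroExtension {f : L2} (hf : f ∈ HHalf00) :
    MemLp (diffQuot (zeroExtension f)) 2 volume ∧
      (eLpNorm (diffQuot (zeroExtension f)) 2 volume).toReal ≤ 2 * normHHalf00 f := by
  have hfm : Measurable f := (Lp.stronglyMeasurable f).measurable
  have hm : Measurable (zeroExtension f) := hfm.indicator measurableSet_Ioi
  set e₁ := eLpNorm (diffQuot f) 2 (vol.prod vol)
  set e₂ := eLpNorm (weighted f) 2 vol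
  have hle : eLpNorm (diffQuot (zeroExtension f)) 2 volume ^ 2 ≤ e₁ ^ 2 + 2 * e₂ ^ 2 := by
    rw [eLpNorm_two_sq]
    refine (lintegral_diffQuot_zeroExtension_le hm fun x hx =>
      indicator_of_notMem (by simpa using hx) _).trans ?_
    gcongr ?_ + 2 * ?_
    · rw [← eLpNorm_two_sq, eLpNorm_congr_ae (diffQuot_congr zeroExtension_ae)]
    · rw [eLpNorm_two_sq]
      refine setLIntegral_mono_ae' measurableSet_Ioi (Eventually.of_forall fun t ht => ?_)
      have ht0 : 0 < t := ht
      have hts := tstar_pos ht0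
      rw [zeroExtension, indicator_of_mem ht, ← ofReal_norm, ← ofReal_norm,
        ← ENNReal.ofReal_pow (norm_nonneg _), ← ENNReal.ofReal_pow (norm_nonneg _),
        ← ENNReal.ofReal_mul (by positivity), Real.norm_eq_abs, Real.norm_eq_abs, sq_abs, sq_abs,
        weighted_sq ht0]
      gcongr
      exact tstar_le
  have h₁ : e₁ ≠ ∞ := hf.1.2.ne
  have h₂ : e₂ ≠ ∞ := hf.2.2.ne
  have hfin : e₁ ^ 2 + 2 * e₂ ^ 2 ≠ ∞ := by finiteness
  have htop : eLpNorm (diffQuot (zeroExtension f)) 2 volume ≠ ∞ := by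
    intro h
    rw [h] at hle
    exact hfin (top_le_iff.1 (by simpa using hle))
  refine ⟨⟨(measurable_diffQuot hm).aestronglyMeasurable, htop.lt_top⟩, ?_⟩
  refine le_of_sq_le_sq ?_ (by linarith [normHHalf00_nonneg f])
  have h3 := ENNReal.toReal_mono hfin hle
  rw [ENNReal.toReal_pow, ENNReal.toReal_add (by finiteness) (by finiteness), ENNReal.toReal_mul,
    ENNReal.toReal_pow, ENNReal.toReal_pow, eLpNorm_two_toReal_sq hf.1, eLpNorm_two_toReal_sq hf.2,
    integral_congr_ae (ae_weighted_sq f), ENNReal.toReal_ofNat] at h3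
  rw [mul_pow, normHHalf00_sq, normHHalf_sq]
  have h4 := integral_tstar_nonneg f
  have h5 : 0 ≤ ∫ t, f t ^ 2 ∂vol := integral_nonneg fun _ => sq_nonneg _
  have h6 : 0 ≤ ∫ p, diffQuot f p ^ 2 ∂(vol.prod vol) := integral_nonneg fun _ => sq_nonneg _
  linarith

theorem diffQuot_evenExtension {g : L2} (hg : g ∈ HHalf) :
    MemLp (diffQuot (evenExtension g)) 2 volume ∧
      (eLpNorm (diffQuot (evenExtension g)) 2 volume).toReal ≤ 2 * normHHalf g := by
  have hgm : Measurable g := (Lp.stronglyMeasurable g).measurable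
  have hm : Measurable (evenExtension g) := hgm.comp measurable_id.abs
  set e := eLpNorm (diffQuot g) 2 (vol.prod vol)
  have hle : eLpNorm (diffQuot (evenExtension g)) 2 volume ^ 2 ≤ 4 * e ^ 2 := by
    rw [eLpNorm_two_sq, eLpNorm_two_sq]
    exact lintegral_diffQuot_even_le hgm
  have h₁ : e ≠ ∞ := hg.2.ne
  have hfin : 4 * e ^ 2 ≠ ∞ := by finiteness
  have htop : eLpNorm (diffQuot (evenExtension g)) 2 volume ≠ ∞ := by
    intro h
    rw [h] at hle
    exact hfin (top_le_iff.1 (by simpa using hle))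
  refine ⟨⟨(measurable_diffQuot hm).aestronglyMeasurable, htop.lt_top⟩, ?_⟩
  refine le_of_sq_le_sq ?_ (by linarith [normHHalf_nonneg g])
  have h3 := ENNReal.toReal_mono hfin hle
  rw [ENNReal.toReal_pow, ENNReal.toReal_mul, ENNReal.toReal_pow, eLpNorm_two_toReal_sq hg,
    ENNReal.toReal_ofNat] at h3
  rw [mul_pow, normHHalf_sq]
  have h5 : 0 ≤ ∫ t, g t ^ 2 ∂vol := integral_nonneg fun _ => sq_nonneg _
  linarith

theorem measurable_zeroExtension (f : L2) : Measurable (zeroExtension f) :=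
  (Lp.stronglyMeasurable f).measurable.indicator measurableSet_Ioi

theorem integrable_lineForm (f : HHalf00) (g : HHalf) :
    Integrable (fun p => signedQuot (zeroExtension f) p *
      diffQuot (evenExtension g) (stepMap p)) :=
  integrable_mul_of_memLp
    (memLp_signedQuot (measurable_zeroExtension f) (diffQuot_zeroExtension f.2).1)
    (memLp_diffQuot_stepMap (diffQuot_evenExtension g.2).1)

/-- The form `∫ f' g` on `H^{1/2}_{00} × H^{1/2}`: up to the constant from the Frullani integral, the
form on the line applied to the zero extension of `f` and the even reflection of `g`. -/
def pairingForm : HHalf00 →ₗ[ℝ] HHalf →ₗ[ℝ] ℝ :=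
  LinearMap.mk₂ ℝ
    (fun f g => -(4 * Real.log 2)⁻¹ * lineForm (zeroExtension f) (evenExtension g))
    (fun f₁ f₂ g => by
      have h : lineForm (zeroExtension ↑(f₁ + f₂)) (evenExtension g) =
          lineForm (zeroExtension f₁) (evenExtension g) +
            lineForm (zeroExtension f₂) (evenExtension g) := by
        rw [Submodule.coe_add, lineForm_congr (zeroExtension_congr (Lp.coeFn_add (f₁ : L2) f₂)) .rfl, lineForm,
          lineForm, lineForm, ← integral_add (integrable_lineForm f₁ g) (integrable_lineForm f₂ g)]
        congr 1 with p
        rw [zeroExtension, indicator_add']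
        simp only [signedQuot, zeroExtension, Pi.add_apply]
        ring
      rw [h, mul_add])
    (fun c f g => by
      have h : lineForm (zeroExtension ↑(c • f)) (evenExtension g) =
          c * lineForm (zeroExtension f) (evenExtension g) := by
        rw [Submodule.coe_smul, lineForm_congr (zeroExtension_congr (Lp.coeFn_smul c (f : L2))) .rfl, lineForm,
          lineForm, ← integral_const_mul]
        have e : zeroExtension (c • ((f : L2) : ℝ → ℝ)) = c • zeroExtension f :=
          indicator_const_smul (Ioi (0 : ℝ)) c (f : L2)
        congr 1 with p
        simp only [e, signedQuot, Pi.smul_apply, smul_eq_mul]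
        ring
      rw [h, smul_eq_mul]
      ring)
    (fun f g₁ g₂ => by
      have h : lineForm (zeroExtension f) (evenExtension ↑(g₁ + g₂)) =
          lineForm (zeroExtension f) (evenExtension g₁) +
            lineForm (zeroExtension f) (evenExtension g₂) := by
        rw [Submodule.coe_add, lineForm_congr .rfl (evenExtension_congr (Lp.coeFn_add (g₁ : L2) g₂)), lineForm,
          lineForm, lineForm, ← integral_add (integrable_lineForm f g₁) (integrable_lineForm f g₂)]
        congr 1 with p
        simp only [diffQuot, evenExtension, Pi.add_apply]
        ring
      rw [h, mul_add])
    (fun c f g => by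
      have h : lineForm (zeroExtension f) (evenExtension ↑(c • g)) =
          c * lineForm (zeroExtension f) (evenExtension g) := by
        rw [Submodule.coe_smul, lineForm_congr .rfl (evenExtension_congr (Lp.coeFn_smul c (g : L2))), lineForm,
          lineForm, ← integral_const_mul]
        congr 1 with p
        simp only [diffQuot, evenExtension, Pi.smul_apply, smul_eq_mul]
        ring
      rw [h, smul_eq_mul]
      ring)

theorem pairingForm_apply (f : HHalf00) (g : HHalf) : pairingForm f g =
    -(4 * Real.log 2)⁻¹ * lineForm (zeroExtension f) (evenExtension g) := rfl

theorem isBoundedForm_pairingForm : IsBoundedForm pairingForm := by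
  refine ⟨|-(4 * Real.log 2)⁻¹| * 4, fun f g => ?_⟩
  rw [pairingForm_apply, abs_mul]
  have h := abs_lineForm_le (measurable_zeroExtension f) (diffQuot_zeroExtension f.2).1
    (diffQuot_evenExtension g.2).1
  have h2 := mul_le_mul (diffQuot_zeroExtension f.2).2 (diffQuot_evenExtension g.2).2
    ENNReal.toReal_nonneg (by linarith [normHHalf00_nonneg f])
  calc _ ≤ |-(4 * Real.log 2)⁻¹| * (2 * normHHalf00 f * (2 * normHHalf g)) :=
        mul_le_mul_of_nonneg_left (h.trans h2) (abs_nonneg _)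
    _ = _ := by ring

/-! ### The form on test functions -/

theorem testFunction_eq_zero (φ : 𝓓(halfLine, ℝ)) {x : ℝ} (hx : x ≤ 0) : φ x = 0 :=
  image_eq_zero_of_notMem_tsupport fun h => not_lt.2 hx (φ.tsupport_subset h)

theorem deriv_testFunction_eq_zero (φ : 𝓓(halfLine, ℝ)) {x : ℝ} (hx : x ≤ 0) : deriv φ x = 0 :=
  image_eq_zero_of_notMem_tsupport fun h =>
    not_lt.2 hx (φ.tsupport_subset (tsupport_deriv_subset h))

theorem contDiff_one_testFunction (φ : 𝓓(halfLine, ℝ)) : ContDiff ℝ 1 φ :=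
  φ.contDiff.of_le (by exact_mod_cast le_top)

theorem continuous_deriv_testFunction (φ : 𝓓(halfLine, ℝ)) : Continuous (deriv φ) :=
  (contDiff_one_testFunction φ).continuous_deriv le_rfl

theorem integral_testFunction_mul_deriv (φ ψ : 𝓓(halfLine, ℝ)) :
    ∫ t in Ioi (0 : ℝ), φ t * deriv ψ t = -∫ t in Ioi (0 : ℝ), deriv φ t * ψ t := by
  have hd : ∀ (χ : 𝓓(halfLine, ℝ)) x, HasDerivAt χ (deriv χ x) x := fun χ x =>
    ((contDiff_one_testFunction χ).differentiable one_ne_zero x).hasDerivAt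
  rw [setIntegral_eq_integral_of_forall_compl_eq_zero fun x hx => by
      rw [testFunction_eq_zero φ (not_lt.1 hx), zero_mul],
    setIntegral_eq_integral_of_forall_compl_eq_zero fun x hx => by
      rw [testFunction_eq_zero ψ (not_lt.1 hx), mul_zero]]
  have hφ := φ.continuous
  have hψ := ψ.continuous
  have hφ' := continuous_deriv_testFunction φ
  have hψ' := continuous_deriv_testFunction ψ
  exact integral_mul_deriv_eq_deriv_mul_of_integrable (fun x _ => hd φ x) (fun x _ => hd ψ x)
    ((hφ.mul hψ').integrable_of_hasCompactSupport φ.hasCompactSupport.mul_right)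
    ((hφ'.mul hψ).integrable_of_hasCompactSupport ψ.hasCompactSupport.mul_left)
    ((hφ.mul hψ).integrable_of_hasCompactSupport φ.hasCompactSupport.mul_right)

theorem pairingForm_test (φ ψ : 𝓓(halfLine, ℝ)) :
    pairingForm (testHHalf00 φ) (testHHalf ψ) = -∫ t in Ioi (0 : ℝ), φ t * deriv ψ t := by
  -- the even reflection of `ψ` is smooth, as `ψ` vanishes near the origin
  set ψe : ℝ → ℝ := fun x => ψ x + ψ (-x) with hψe
  have hzero : zeroExtension (testL2 φ) =ᵐ[volume] φ := by
    refine (zeroExtension_congr (testL2_ae φ)).trans (Eventually.of_forall fun x => ?_)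
    by_cases hx : x ∈ Ioi (0 : ℝ)
    · rw [zeroExtension, indicator_of_mem hx]
    · rw [zeroExtension, indicator_of_notMem hx, testFunction_eq_zero φ (not_lt.1 hx)]
  have heven : evenExtension (testL2 ψ) =ᵐ[volume] ψe := by
    refine (evenExtension_congr (testL2_ae ψ)).trans (Eventually.of_forall fun x => ?_)
    simp only [evenExtension, hψe]
    rcases le_total 0 x with hx | hx
    · rw [abs_of_nonneg hx, testFunction_eq_zero ψ (neg_nonpos.2 hx), add_zero]
    · rw [abs_of_nonpos hx, testFunction_eq_zero ψ hx, zero_add]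
  have quot_congr : ∀ {u v : ℝ → ℝ}, u =ᵐ[volume] v → MemLp (diffQuot u) 2 volume →
      MemLp (diffQuot v) 2 volume := by
    intro u v h hu
    refine (memLp_congr_ae ?_).1 hu
    filter_upwards [ae_fst_snd h] with p hp
    simp only [diffQuot, hp.1, hp.2]
  have hψ1 := contDiff_one_testFunction ψ
  have hψc : HasCompactSupport ψe :=
    ψ.hasCompactSupport.add (ψ.hasCompactSupport.comp_homeomorph (Homeomorph.neg ℝ))
  have hkey := lineForm_eq φ.continuous φ.hasCompactSupport
    (quot_congr hzero (diffQuot_zeroExtension (testL2_mem_HHalf00 φ)).1)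
    (β := ψe) (hψ1.add (hψ1.comp contDiff_neg)) hψc
    (quot_congr heven (diffQuot_evenExtension (testL2_mem_HHalf ψ)).1)
  have hint : ∫ x, φ x * deriv ψe x = ∫ t in Ioi (0 : ℝ), φ t * deriv ψ t := by
    rw [← setIntegral_eq_integral_of_forall_compl_eq_zero (s := Ioi (0 : ℝ)) fun x hx => by
      rw [testFunction_eq_zero φ (not_lt.1 hx), zero_mul]]
    refine setIntegral_congr_fun measurableSet_Ioi fun x hx => ?_
    have hx0 : 0 < x := hx
    have hψd : Differentiable ℝ ψ := hψ1.differentiable one_ne_zero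
    have hψn : DifferentiableAt ℝ (fun y => ψ (-y)) x :=
      (hψd (-x)).comp x differentiable_neg.differentiableAt
    have h1 : deriv ψe x = deriv ψ x + -deriv ψ (-x) := by
      rw [hψe, deriv_fun_add (hψd x) hψn, deriv_comp_neg]
    simp only [h1, deriv_testFunction_eq_zero ψ (neg_nonpos.2 hx0.le), neg_zero, add_zero]
  rw [pairingForm_apply]
  change -(4 * Real.log 2)⁻¹ *
    lineForm (zeroExtension (testL2 φ)) (evenExtension (testL2 ψ)) = _
  rw [lineForm_congr hzero heven, hkey, hint]
  have hlog : Real.log 2 ≠ 0 := (Real.log_pos one_lt_two).ne'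
  field_simp

theorem extendsPairing_pairingForm : ExtendsPairing pairingForm := fun φ ψ => by
  rw [pairingForm_test, integral_testFunction_mul_deriv, neg_neg]

/-! ### The form and weak derivatives -/

/-- The derivative of a test function as an element of `L²(0, ∞)`. -/
def derivTestL2 (φ : 𝓓(halfLine, ℝ)) : L2 :=
  MemLp.toLp (deriv φ) (((continuous_deriv_testFunction φ).memLp_of_hasCompactSupport
    φ.hasCompactSupport.deriv).restrict _)

theorem derivTestL2_ae (φ : 𝓓(halfLine, ℝ)) : derivTestL2 φ =ᵐ[vol] deriv φ :=
  MemLp.coeFn_toLp _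

theorem inner_L2 (u v : L2) : inner ℝ u v = ∫ t, u t * v t ∂vol := by
  rw [L2.inner_def]
  simp [mul_comm]

theorem inner_testL2 (u : L2) (φ : 𝓓(halfLine, ℝ)) :
    inner ℝ u (testL2 φ) = ∫ t, u t * φ t ∂vol := by
  rw [inner_L2]
  refine integral_congr_ae ?_
  filter_upwards [testL2_ae φ] with t ht
  rw [ht]

theorem inner_derivTestL2 (u : L2) (φ : 𝓓(halfLine, ℝ)) :
    inner ℝ u (derivTestL2 φ) = ∫ t, u t * deriv φ t ∂vol := by
  rw [inner_L2]
  refine integral_congr_ae ?_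
  filter_upwards [derivTestL2_ae φ] with t ht
  rw [ht]

theorem inner_testL2_derivTestL2 (φ ψ : 𝓓(halfLine, ℝ)) :
    inner ℝ (testL2 φ) (derivTestL2 ψ) = ∫ t in Ioi (0 : ℝ), φ t * deriv ψ t := by
  rw [inner_derivTestL2]
  refine integral_congr_ae ?_
  filter_upwards [testL2_ae φ] with t ht
  rw [ht]

/-- The functional `f ↦ ⟨u, f⟩` on a subspace of `L²(0, ∞)`. -/
def innerFunctional (u : L2) (S : Submodule ℝ L2) : S →ₗ[ℝ] ℝ := innerₛₗ ℝ u ∘ₗ S.subtype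

theorem innerFunctional_apply (u : L2) (S : Submodule ℝ L2) (f : S) :
    innerFunctional u S f = inner ℝ u (f : L2) := rfl

theorem innerFunctional_bounded_HHalf (u : L2) :
    ∃ C, ∀ g : HHalf, |innerFunctional u HHalf g| ≤ C * normHHalf g :=
  ⟨‖u‖, fun g => (abs_real_inner_le_norm u g).trans
    (mul_le_mul_of_nonneg_left (norm_le_normHHalf g) (norm_nonneg u))⟩

theorem innerFunctional_bounded_HHalf00 (u : L2) :
    ∃ C, ∀ f : HHalf00, |innerFunctional u HHalf00 f| ≤ C * normHHalf00 f :=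
  ⟨‖u‖, fun f => (abs_real_inner_le_norm u f).trans (mul_le_mul_of_nonneg_left
    ((norm_le_normHHalf f).trans (normHHalf_le_normHHalf00 f)) (norm_nonneg u))⟩

theorem IsBoundedForm.apply {B : HHalf00 →ₗ[ℝ] HHalf →ₗ[ℝ] ℝ} (hB : IsBoundedForm B)
    (f : HHalf00) : ∃ C, ∀ g, |B f g| ≤ C * normHHalf g := by
  obtain ⟨C, hC⟩ := hB
  exact ⟨C * normHHalf00 f, hC f⟩

theorem IsBoundedForm.flip_apply {B : HHalf00 →ₗ[ℝ] HHalf →ₗ[ℝ] ℝ} (hB : IsBoundedForm B)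
    (g : HHalf) : ∃ C, ∀ f, |B.flip g f| ≤ C * normHHalf00 f := by
  obtain ⟨C, hC⟩ := hB
  refine ⟨C * normHHalf g, fun f => (hC f g).trans (le_of_eq (by ring))⟩

/-- Bounded forms are determined by their values on test functions. -/
theorem IsBoundedForm.ext {B B' : HHalf00 →ₗ[ℝ] HHalf →ₗ[ℝ] ℝ} (hB : IsBoundedForm B)
    (hB' : IsBoundedForm B')
    (h : ∀ φ ψ, B (testHHalf00 φ) (testHHalf ψ) = B' (testHHalf00 φ) (testHHalf ψ)) : B = B' := by
  ext1 f
  refine HHalf.functional_ext (hB.apply f) (hB'.apply f) fun ψ => ?_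
  exact LinearMap.congr_fun (HHalf00.functional_ext (hB.flip_apply (testHHalf ψ))
    (hB'.flip_apply (testHHalf ψ)) fun φ => h φ ψ) f

/-- For a test function `ψ` both sides are bounded in `f`, so that the identity extends from test
functions to all of `H^{1/2}_{00}`. -/
theorem pairingForm_test_right (f : HHalf00) (ψ : 𝓓(halfLine, ℝ)) :
    pairingForm f (testHHalf ψ) = -∫ t, (f : L2) t * deriv ψ t ∂vol := by
  have hb : ∃ C, ∀ f : HHalf00, |(-innerFunctional (derivTestL2 ψ) HHalf00) f| ≤
      C * normHHalf00 f := by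
    simpa only [LinearMap.neg_apply, abs_neg] using innerFunctional_bounded_HHalf00 (derivTestL2 ψ)
  have h := HHalf00.functional_ext (isBoundedForm_pairingForm.flip_apply (testHHalf ψ)) hb
    fun φ => by
      rw [LinearMap.flip_apply, pairingForm_test, LinearMap.neg_apply, innerFunctional_apply,
        real_inner_comm, ← inner_testL2_derivTestL2]
      rfl
  have h2 := LinearMap.congr_fun h f
  rw [LinearMap.flip_apply, LinearMap.neg_apply, innerFunctional_apply, real_inner_comm,
    inner_derivTestL2] at h2
  exact h2

theorem pairingForm_test_left (φ : 𝓓(halfLine, ℝ)) (g : HHalf) :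
    pairingForm (testHHalf00 φ) g = ∫ t, (g : L2) t * deriv φ t ∂vol := by
  have h := HHalf.functional_ext (isBoundedForm_pairingForm.apply (testHHalf00 φ))
    (innerFunctional_bounded_HHalf (derivTestL2 φ)) fun ψ => by
      rw [pairingForm_test, integral_testFunction_mul_deriv, neg_neg, innerFunctional_apply,
        real_inner_comm]
      refine Eq.trans ?_ (inner_testL2_derivTestL2 ψ φ).symm
      simp only [mul_comm]
  have h2 := LinearMap.congr_fun h g
  rw [innerFunctional_apply, real_inner_comm, inner_derivTestL2] at h2
  exact h2

/-- On test functions `ψ` the claim is the definition of the weak derivative; it extends by density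
of the test functions in `H^{1/2}`. -/
theorem pairingForm_of_hasWeakDeriv_left (f : HHalf00) (g : HHalf) {f' : L2}
    (hf : HasWeakDeriv f f') : pairingForm f g = ∫ t, f' t * (g : L2) t ∂vol := by
  have h := HHalf.functional_ext (isBoundedForm_pairingForm.apply f)
    (innerFunctional_bounded_HHalf f') fun ψ => by
      rw [pairingForm_test_right, hf ψ, neg_neg]
      exact (inner_testL2 f' ψ).symm
  rw [h, innerFunctional_apply, inner_L2]

theorem pairingForm_of_hasWeakDeriv_right (f : HHalf00) (g : HHalf) {g' : L2}
    (hg : HasWeakDeriv g g') : pairingForm f g = -∫ t, (f : L2) t * g' t ∂vol := by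
  have hb : ∃ C, ∀ f : HHalf00, |(-innerFunctional g' HHalf00) f| ≤ C * normHHalf00 f := by
    simpa only [LinearMap.neg_apply, abs_neg] using innerFunctional_bounded_HHalf00 g'
  have h := HHalf00.functional_ext (isBoundedForm_pairingForm.flip_apply g) hb fun φ => by
    rw [LinearMap.flip_apply, pairingForm_test_left, hg φ]
    exact congrArg Neg.neg (inner_testL2 g' φ).symm
  have h2 := LinearMap.congr_fun h f
  rw [LinearMap.flip_apply, LinearMap.neg_apply, innerFunctional_apply, real_inner_comm,
    inner_L2] at h2
  exact h2

end HalfLine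

end

theorem lemma2p2 :
    ∃ B : HalfLine.HHalf00 →ₗ[ℝ] HalfLine.HHalf →ₗ[ℝ] ℝ,
      HalfLine.IsBoundedForm B ∧
      HalfLine.ExtendsPairing B ∧
      (∀ φ ψ : 𝓓(HalfLine.halfLine, ℝ),
        B (HalfLine.testHHalf00 φ) (HalfLine.testHHalf ψ) =
          -∫ t in Ioi (0 : ℝ), φ t * deriv ψ t) ∧
      (∀ (f : HalfLine.HHalf00) (g : HalfLine.HHalf) (f' : HalfLine.L2),
        HalfLine.HasWeakDeriv f f' →
          B f g = ∫ t in Ioi (0 : ℝ), f' t * (g : HalfLine.L2) t) ∧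
      (∀ (f : HalfLine.HHalf00) (g : HalfLine.HHalf) (g' : HalfLine.L2),
        HalfLine.HasWeakDeriv g g' →
          B f g = -∫ t in Ioi (0 : ℝ), (f : HalfLine.L2) t * g' t) ∧
      (∀ B' : HalfLine.HHalf00 →ₗ[ℝ] HalfLine.HHalf →ₗ[ℝ] ℝ,
        HalfLine.IsBoundedForm B' → HalfLine.ExtendsPairing B' → B' = B) :=
  ⟨HalfLine.pairingForm, HalfLine.isBoundedForm_pairingForm,
    HalfLine.extendsPairing_pairingForm, HalfLine.pairingForm_test,
    fun f g _ hf => HalfLine.pairingForm_of_hasWeakDeriv_left f g hf,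
    fun f g _ hg => HalfLine.pairingForm_of_hasWeakDeriv_right f g hg,
    fun _ hB' hE => hB'.ext HalfLine.isBoundedForm_pairingForm fun φ ψ =>
      (hE φ ψ).trans (HalfLine.extendsPairing_pairingForm φ ψ).symm⟩
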